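/- Let $p\ge 5$ be a prime. For $F=\sum_{h\ge -m} f_hX^{-h}\in\mathbf F_p((X^{-1}))$ with $f_{-m}\neq 0$ put $|F|=2^m$, put $|0|=0$, and let $\|F\|$ be the norm of the fractional part of $F$ (the part of the series with the negative powers of $X$). Call $F$ badly approximable if $\inf_{q}|q|\cdot\|qF\|>0$, the infimum being over the non-zero $q\in\mathbf F_p[X]$. Say that a pair $(\Theta,\Phi)$ satisfies the Littlewood conjecture non-trivially if $$\inf_{q\in\mathbf F_p[X]\setminus\{0\}}|q|\cdot\|q\Theta\|\cdot\|q\Phi\|=0,$$ both $\Theta$ and $\Phi$ are badly approximable, and $1,\Theta,\Phi$ are linearly independent over $\mathbf F_p[X]$. Continued fractions $[a_0,a_1,a_2,\ldots]$ are taken with respect to polynomial parts. For $k\ge 0$ let $L_k(3)$ be the word consisting of $(p^k-1)/2$ copies of $X/3,\,3X$, and let $L_k(-1)$ be the word consisting of $(p^k-1)/2$ copies of $-X,\,-X$ (both are empty for $k=0$). For $k\ge 1$ let $f_k=\sum_{0\le 2j\le k}\binom{k-j}{j}X^{k-2j}\in\mathbf F_p[X]$. **Theorem 8.** There are a unique series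 $\Theta_p\in\mathbf F_p((X^{-1}))$ with the continued fraction expansion $$\Theta_p=[X,L_0(3),-X/3,L_0(-1),X,L_1(3),-X/3,L_1(-1),X,L_2(3),-X/3,L_2(-1),\ldots]$$ and a unique series $\Phi_p\in\mathbf F_p((X^{-1}))$ with the continued fraction expansion $$\Phi_p=[3X,X/3,3X,X/3,3X,\ldots].$$ The series $\Theta_p$ is a root of the polynomial $$XZ^{p+1}-(X^2-3)Z^p+(Xf_{p-2}-3f_{p-1})Z-f_{p-2}(X^2-3)+3f_{p-1}X$$ and is algebraic of degree $p+1$ over $\mathbf F_p(X)$; the series $\Phi_p$ is algebraic of degree $2$ over $\mathbf F_p(X)$. The pair $(\Theta_p,\Phi_p)$ satisfies the Littlewood conjecture non-trivially. -/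

import Mathlib

open Polynomial

/-! The field `K((X⁻¹))` is modelled as `LaurentSeries K`, the Laurent series in `T = X⁻¹`:
the coefficient of `T ^ i` is the coefficient of `X ^ (-i)`. -/

section General

variable {K : Type*} [Field K]

/-- The embedding of `K[X]` in `K((X⁻¹))`, sending `X` to `T⁻¹`. -/
noncomputable def polyEmb : K[X] →+* LaurentSeries K :=
  Polynomial.eval₂RingHom HahnSeries.C (HahnSeries.single (-1 : ℤ) (1 : K))

open Classical in
/-- The norm `|F|`: `|0| = 0`, and `|F| = 2 ^ m` if `X ^ m` is the highest power of `X` that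
occurs in `F` (so that `m` is minus the order of `F` in `T`). -/
noncomputable def absVal (F : LaurentSeries K) : ℝ :=
  if F = 0 then 0 else (2 : ℝ) ^ (-F.order)

/-- The polynomial part of `F`: the part of the series with the powers `X ^ i`, `i ≥ 0`. -/
noncomputable def polyPart (F : LaurentSeries K) : K[X] :=
  ∑ i ∈ Finset.range ((-F.order).toNat + 1), Polynomial.monomial i (F.coeff (-(i : ℤ)))

/-- The fractional part of `F`: the part of the series with the negative powers of `X`. -/
noncomputable def fracPart (F : LaurentSeries K) : LaurentSeries K :=
  F - polyEmb (polyPart F)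

/-- `‖F‖`, the norm of the fractional part of `F`. -/
noncomputable def fracNorm (F : LaurentSeries K) : ℝ :=
  absVal (fracPart F)

/-- `F` is badly approximable: `inf |q| ‖q F‖ > 0` over the nonzero polynomials `q`. -/
def BadlyApproximable (F : LaurentSeries K) : Prop :=
  0 < ⨅ q : {q : K[X] // q ≠ 0}, absVal (polyEmb q.1) * fracNorm (polyEmb q.1 * F)

/-- The pair satisfies the Littlewood conjecture:
`inf |q| ‖q Θ‖ ‖q Φ‖ = 0` over the nonzero polynomials `q`. -/
def Littlewood (Θ Φ : LaurentSeries K) : Prop :=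
  ⨅ q : {q : K[X] // q ≠ 0},
    absVal (polyEmb q.1) * fracNorm (polyEmb q.1 * Θ) * fracNorm (polyEmb q.1 * Φ) = 0

/-- `1`, `Θ`, `Φ` are linearly independent over `K[X]`. -/
def OneLinIndep (Θ Φ : LaurentSeries K) : Prop :=
  ∀ a b c : K[X], polyEmb a + polyEmb b * Θ + polyEmb c * Φ = 0 → a = 0 ∧ b = 0 ∧ c = 0

/-- The pair satisfies the Littlewood conjecture non-trivially: both series are badly
approximable, and `1`, `Θ`, `Φ` are linearly independent over `K[X]`. -/
def LittlewoodNontrivially (Θ Φ : LaurentSeries K) : Prop :=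
  Littlewood Θ Φ ∧ BadlyApproximable Θ ∧ BadlyApproximable Φ ∧ OneLinIndep Θ Φ

/-- The complete quotients of the continued fraction algorithm:
`F₀ = F` and `Fₙ₊₁ = 1 / (Fₙ - aₙ)`, with `aₙ` the polynomial part of `Fₙ`. -/
noncomputable def completeQuotient (F : LaurentSeries K) : ℕ → LaurentSeries K
  | 0 => F
  | n + 1 => (fracPart (completeQuotient F n))⁻¹

/-- `F = [a₀, a₁, a₂, …]`: the continued fraction algorithm applied to `F` never stops, and its
partial quotients are the `aₙ`. -/
def HasContFrac (F : LaurentSeries K) (a : ℕ → K[X]) : Prop :=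
  ∀ n, fracPart (completeQuotient F n) ≠ 0 ∧ polyPart (completeQuotient F n) = a n

/-- `F` is algebraic over `K(X)`, of degree `d`: `d` is the least degree (in the outer variable)
of a nonzero polynomial over `K[X]` that vanishes at `F`. -/
def HasAlgDegree (F : LaurentSeries K) (d : ℕ) : Prop :=
  IsLeast {n : ℕ | ∃ P : K[X][X], P ≠ 0 ∧ P.eval₂ polyEmb F = 0 ∧ P.natDegree = n} d

end General

section MillsRobbins

variable (p : ℕ) [Fact p.Prime]

/-- `f_k = ∑_{0 ≤ 2j ≤ k} (k-j choose j) X ^ (k - 2j)` in `F_p[X]`. -/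
noncomputable def mrF (k : ℕ) : (ZMod p)[X] :=
  ∑ j ∈ Finset.range (k / 2 + 1), C (((k - j).choose j : ℕ) : ZMod p) * X ^ (k - 2 * j)

/-- The polynomial `X Z^(p+1) - (X^2 - 3) Z^p + (X f_(p-2) - 3 f_(p-1)) Z
- f_(p-2) (X^2 - 3) + 3 f_(p-1) X`; the outer variable is `Z`. -/
noncomputable def mrPoly : (ZMod p)[X][X] :=
  C (X : (ZMod p)[X]) * X ^ (p + 1) - C (X ^ 2 - 3 : (ZMod p)[X]) * X ^ p
    + C (X * mrF p (p - 2) - 3 * mrF p (p - 1)) * X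
    + C (-(mrF p (p - 2) * (X ^ 2 - 3)) + 3 * mrF p (p - 1) * X)

/-- The polynomial `X / 3` of `F_p[X]`. -/
noncomputable def xDivThree : (ZMod p)[X] := C ((3 : ZMod p)⁻¹) * X

/-- The word `L_k(3)`: `(p^k - 1) / 2` copies of `X/3, 3X`. -/
noncomputable def wordLThree (k : ℕ) : List ((ZMod p)[X]) :=
  (List.replicate ((p ^ k - 1) / 2) [xDivThree p, 3 * X]).flatten

/-- The word `L_k(-1)`: `(p^k - 1) / 2` copies of `-X, -X`. -/
noncomputable def wordLNegOne (k : ℕ) : List ((ZMod p)[X]) :=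
  (List.replicate ((p ^ k - 1) / 2) [-X, -X]).flatten

/-- The word `X, L_k(3), -X/3, L_k(-1)`. -/
noncomputable def thetaBlock (k : ℕ) : List ((ZMod p)[X]) :=
  X :: (wordLThree p k ++ (-xDivThree p) :: wordLNegOne p k)

/-- The infinite word obtained by concatenating the blocks `0, 1, 2, …`. Its letter with index `n`
is read off the first `n + 1` blocks, whose concatenation has at least `2 (n + 1)` letters, so
that the default value `0` is never used. -/
noncomputable def thetaQuotients (n : ℕ) : (ZMod p)[X] :=
  ((List.range (n + 1)).flatMap (thetaBlock p)).getD n 0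

/-- The sequence `3X, X/3, 3X, X/3, …`. -/
noncomputable def phiQuotients (n : ℕ) : (ZMod p)[X] :=
  if Even n then 3 * X else xDivThree p

end MillsRobbins

/-! Write `M(a) = !![a, 1; 1, 0]`, `g = f_(p-1)`, `h = f_(p-2)` and `T = !![1, h; 0, g]`.
The powers of `M(X)` have the `f_k` as entries, and this yields `B T = T C` for the product `B`
of the matrices `M(a)` over the block `k + 1` of `Θ` and the image `C` under the Frobenius of the
product over the block `k`. So the map `F ↦ (F ^ p + h) / g` takes the tail of `Θ` that starts at
the block `k` to the tail that starts at the block `k + 1`. For `k = 0`, the tail after the first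
block is on the one hand `(Θ ^ p + h) / g`, and on the other hand a fractional linear function
of `Θ`: this is the equation of degree `p + 1`.

Let `q` be the denominator of the convergent of `Θ` that ends with `L_k(3)`. Then `|q| ‖q Θ‖ ≤ 1`,
and by reversal of the continued fraction the quotient of `q` and the preceding denominator starts
with a long part of the expansion of `Φ`, so that `‖q Φ‖` is arbitrarily small. Both series are
badly approximable because their partial quotients have bounded degree.

Over `𝔽ₚ((X⁻¹))` the polynomial splits as `(Z - Θ) R`, where the Newton polygon of `R` is a single
segment of slope `(p - 2) / p`. Hence `R` is irreducible, and a proper divisor over `𝔽ₚ(X)` of the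
polynomial that vanishes at `Θ` would be `Z - Θ`, which is excluded because `Θ` is irrational. -/

section Valuation

variable {K : Type*} [Field K]

lemma absVal_zero : absVal (0 : LaurentSeries K) = 0 := by simp [absVal]

lemma absVal_of_ne_zero {F : LaurentSeries K} (hF : F ≠ 0) :
    absVal F = (2 : ℝ) ^ (-F.order) := by simp [absVal, hF]

lemma absVal_nonneg (F : LaurentSeries K) : 0 ≤ absVal F := by
  unfold absVal; split_ifs <;> positivity

lemma absVal_eq_zero {F : LaurentSeries K} : absVal F = 0 ↔ F = 0 := by
  constructor
  · intro h
    by_contra hF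
    rw [absVal_of_ne_zero hF] at h
    have : (0 : ℝ) < (2 : ℝ) ^ (-F.order) := by positivity
    linarith
  · rintro rfl; exact absVal_zero

lemma absVal_mul (F G : LaurentSeries K) : absVal (F * G) = absVal F * absVal G := by
  by_cases hF : F = 0
  · simp [hF, absVal_zero]
  by_cases hG : G = 0
  · simp [hG, absVal_zero]
  rw [absVal_of_ne_zero (mul_ne_zero hF hG), absVal_of_ne_zero hF, absVal_of_ne_zero hG,
    HahnSeries.order_mul hF hG, ← zpow_add₀ (by norm_num)]
  congr 1; ring

lemma absVal_add_le_max (F G : LaurentSeries K) :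
    absVal (F + G) ≤ max (absVal F) (absVal G) := by
  by_cases hF : F = 0
  · simp [hF]
  by_cases hG : G = 0
  · simp [hG]
  by_cases hFG : F + G = 0
  · rw [hFG, absVal_zero]; exact le_max_of_le_left (absVal_nonneg F)
  rw [absVal_of_ne_zero hFG, absVal_of_ne_zero hF, absVal_of_ne_zero hG]
  have h := HahnSeries.min_order_le_order_add hFG
  rcases min_le_iff.mp h with h | h
  · exact le_max_of_le_left (zpow_le_zpow_right₀ (by norm_num) (by omega))
  · exact le_max_of_le_right (zpow_le_zpow_right₀ (by norm_num) (by omega))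

/-- The norm of `K((X⁻¹))` as an absolute value. -/
noncomputable def laurentAbs (K : Type*) [Field K] : AbsoluteValue (LaurentSeries K) ℝ where
  toFun := absVal
  map_mul' := absVal_mul
  nonneg' := absVal_nonneg
  eq_zero' _ := absVal_eq_zero
  add_le' F G := (absVal_add_le_max F G).trans
    (max_le (by linarith [absVal_nonneg G]) (by linarith [absVal_nonneg F]))

lemma laurentAbs_isNonarchimedean : IsNonarchimedean (laurentAbs K) := absVal_add_le_max

lemma absVal_one : absVal (1 : LaurentSeries K) = 1 := (laurentAbs K).map_one

lemma absVal_neg (F : LaurentSeries K) : absVal (-F) = absVal F := (laurentAbs K).map_neg F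

lemma absVal_sub_comm (F G : LaurentSeries K) : absVal (F - G) = absVal (G - F) := by
  rw [← absVal_neg, neg_sub]

lemma absVal_inv (F : LaurentSeries K) : absVal F⁻¹ = (absVal F)⁻¹ := map_inv₀ (laurentAbs K) F

lemma absVal_div (F G : LaurentSeries K) : absVal (F / G) = absVal F / absVal G :=
  map_div₀ (laurentAbs K) F G

lemma absVal_pow (F : LaurentSeries K) (n : ℕ) : absVal (F ^ n) = absVal F ^ n :=
  map_pow (laurentAbs K) F n

lemma absVal_pos {F : LaurentSeries K} (hF : F ≠ 0) : 0 < absVal F := (laurentAbs K).pos hF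

lemma absVal_add_eq_left {F G : LaurentSeries K} (h : absVal G < absVal F) :
    absVal (F + G) = absVal F :=
  laurentAbs_isNonarchimedean.add_eq_left_of_lt (f := laurentAbs K) h

lemma absVal_sub_le_max (F G : LaurentSeries K) :
    absVal (F - G) ≤ max (absVal F) (absVal G) := by
  rw [sub_eq_add_neg, ← absVal_neg G]; exact absVal_add_le_max _ _

lemma absVal_le_two_zpow_iff {F : LaurentSeries K} {m : ℤ} :
    absVal F ≤ 2 ^ (-m) ↔ ∀ i < m, F.coeff i = 0 := by
  by_cases hF : F = 0
  · subst hF; simp only [absVal_zero, HahnSeries.coeff_zero, implies_true, iff_true]; positivity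
  rw [absVal_of_ne_zero hF, zpow_le_zpow_iff_right₀ (by norm_num), neg_le_neg_iff,
    HahnSeries.le_order_iff_forall hF]

lemma absVal_lt_one_iff {F : LaurentSeries K} :
    absVal F < 1 ↔ ∀ i ≤ 0, F.coeff i = 0 := by
  by_cases hF : F = 0
  · subst hF; simp [absVal_zero]
  have h : absVal F < 1 ↔ absVal F ≤ 2 ^ (-1 : ℤ) := by
    rw [absVal_of_ne_zero hF, zpow_le_zpow_iff_right₀ (by norm_num)]
    have := zpow_lt_zpow_iff_right₀ (a := (2 : ℝ)) (by norm_num) (m := -F.order) (n := 0)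
    rw [zpow_zero] at this
    rw [this]; omega
  rw [h, absVal_le_two_zpow_iff]
  exact ⟨fun h i hi => h i (by omega), fun h i hi => h i (by omega)⟩

lemma polyEmb_monomial (n : ℕ) (r : K) :
    polyEmb (monomial n r) = HahnSeries.single (-(n : ℤ)) r := by
  simp [polyEmb, HahnSeries.C_apply, HahnSeries.single_pow]

lemma polyEmb_coeff_neg (a : K[X]) (i : ℕ) : (polyEmb a).coeff (-(i : ℤ)) = a.coeff i := by
  induction a using Polynomial.induction_on' with
  | add a b ha hb => simp [ha, hb]
  | monomial n r =>
    rw [polyEmb_monomial, HahnSeries.coeff_single, coeff_monomial]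
    by_cases h : n = i
    · simp [h]
    · rw [if_neg (by omega), if_neg h]

lemma polyEmb_injective : Function.Injective (polyEmb : K[X] →+* LaurentSeries K) := by
  rw [injective_iff_map_eq_zero]
  intro a ha
  ext i
  rw [← polyEmb_coeff_neg, ha]; simp

lemma polyEmb_eq_zero {a : K[X]} : polyEmb a = 0 ↔ a = 0 :=
  map_eq_zero_iff _ polyEmb_injective

lemma polyEmb_ne_zero {a : K[X]} (ha : a ≠ 0) : polyEmb a ≠ 0 := polyEmb_eq_zero.not.mpr ha

lemma order_polyEmb {a : K[X]} (ha : a ≠ 0) : (polyEmb a).order = -(a.natDegree : ℤ) := by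
  apply le_antisymm
  · apply HahnSeries.order_le_of_coeff_ne_zero
    rw [polyEmb_coeff_neg]
    simpa using ha
  · rw [HahnSeries.le_order_iff_forall (polyEmb_ne_zero ha)]
    intro i hi
    obtain ⟨n, rfl⟩ : ∃ n : ℕ, i = -(n : ℤ) := ⟨(-i).toNat, by omega⟩
    rw [polyEmb_coeff_neg]
    exact coeff_eq_zero_of_natDegree_lt (by omega)

lemma absVal_polyEmb {a : K[X]} (ha : a ≠ 0) : absVal (polyEmb a) = 2 ^ a.natDegree := by
  rw [absVal_of_ne_zero (polyEmb_ne_zero ha), order_polyEmb ha, neg_neg, zpow_natCast]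

lemma one_le_absVal_polyEmb {a : K[X]} (ha : a ≠ 0) : 1 ≤ absVal (polyEmb a) := by
  rw [absVal_polyEmb ha]; exact one_le_pow₀ (by norm_num)

lemma absVal_polyEmb_lt_iff {a b : K[X]} :
    absVal (polyEmb a) < absVal (polyEmb b) ↔ a.degree < b.degree := by
  rcases eq_or_ne b 0 with rfl | hb
  · simp [absVal_zero, absVal_nonneg]
  rcases eq_or_ne a 0 with rfl | ha
  · simp [absVal_zero, absVal_pos (polyEmb_ne_zero hb), bot_lt_iff_ne_bot, hb]
  rw [absVal_polyEmb ha, absVal_polyEmb hb, pow_lt_pow_iff_right₀ (by norm_num),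
    natDegree_lt_natDegree_iff ha]

lemma polyEmb_polyPart_coeff (F : LaurentSeries K) {i : ℤ} (hi : i ≤ 0) :
    (polyEmb (polyPart F)).coeff i = F.coeff i := by
  obtain ⟨n, rfl⟩ : ∃ n : ℕ, i = -(n : ℤ) := ⟨(-i).toNat, by omega⟩
  rw [polyEmb_coeff_neg, polyPart, finsetSum_coeff]
  simp only [coeff_monomial, Finset.sum_ite_eq', Finset.mem_range]
  split_ifs with h
  · rfl
  · rw [HahnSeries.coeff_eq_zero_of_lt_order]
    omega

lemma absVal_fracPart_lt_one (F : LaurentSeries K) : absVal (fracPart F) < 1 := by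
  rw [absVal_lt_one_iff]
  intro i hi
  rw [fracPart, HahnSeries.coeff_sub, polyEmb_polyPart_coeff F hi, sub_self]

lemma polyEmb_polyPart_add_fracPart (F : LaurentSeries K) :
    polyEmb (polyPart F) + fracPart F = F := by rw [fracPart]; ring

lemma eq_zero_of_absVal_polyEmb_lt_one {a : K[X]} (h : absVal (polyEmb a) < 1) : a = 0 := by
  by_contra ha
  exact absurd (one_le_absVal_polyEmb ha) (not_le.mpr h)

lemma polyPart_eq {F : LaurentSeries K} {a : K[X]} (h : absVal (F - polyEmb a) < 1) :
    polyPart F = a := by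
  rw [← sub_eq_zero]
  apply eq_zero_of_absVal_polyEmb_lt_one
  have : polyEmb (polyPart F - a) = (F - polyEmb a) - fracPart F := by
    rw [fracPart, map_sub]; ring
  rw [this]
  exact (absVal_sub_le_max _ _).trans_lt (max_lt h (absVal_fracPart_lt_one F))

lemma fracPart_eq {F : LaurentSeries K} {a : K[X]} (h : absVal (F - polyEmb a) < 1) :
    fracPart F = F - polyEmb a := by rw [fracPart, polyPart_eq h]

lemma fracNorm_le (F : LaurentSeries K) (r : K[X]) : fracNorm F ≤ absVal (F - polyEmb r) := by
  by_cases h : absVal (F - polyEmb r) < 1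
  · rw [fracNorm, fracPart_eq h]
  · exact (absVal_fracPart_lt_one F).le.trans (not_lt.mp h)

lemma fracNorm_nonneg (F : LaurentSeries K) : 0 ≤ fracNorm F := absVal_nonneg _

lemma eq_of_forall_absVal_sub_le {F G : LaurentSeries K}
    (h : ∀ n : ℕ, absVal (F - G) ≤ 2 ^ (-(n : ℤ))) : F = G := by
  rw [← sub_eq_zero]
  ext i
  exact absVal_le_two_zpow_iff.mp (h (i.toNat + 1)) i (by omega)

lemma absVal_sub_le_of_forall_succ_sub_le {F : ℕ → LaurentSeries K}
    (hF : ∀ n, absVal (F (n + 1) - F n) ≤ 2 ^ (-(n : ℤ))) {m n : ℕ} (h : n ≤ m) :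
    absVal (F m - F n) ≤ 2 ^ (-(n : ℤ)) := by
  induction m, h using Nat.le_induction with
  | base => rw [sub_self, absVal_zero]; positivity
  | succ m hm ih =>
    rw [← sub_add_sub_cancel _ (F m)]
    refine (absVal_add_le_max _ _).trans (max_le ((hF m).trans ?_) ih)
    exact zpow_le_zpow_right₀ (by norm_num) (by omega)

lemma exists_forall_absVal_sub_le {F : ℕ → LaurentSeries K}
    (hF : ∀ n, absVal (F (n + 1) - F n) ≤ 2 ^ (-(n : ℤ))) :
    ∃ L, ∀ n : ℕ, absVal (L - F n) ≤ 2 ^ (-(n : ℤ)) := by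
  have coeff_stable {m n : ℕ} (h : n ≤ m) {i : ℤ} (hi : i < n) :
      (F m).coeff i = (F n).coeff i := by
    have := absVal_le_two_zpow_iff.mp (absVal_sub_le_of_forall_succ_sub_le hF h) i hi
    rwa [HahnSeries.coeff_sub, sub_eq_zero] at this
  have hbdd : BddBelow (Function.support fun i : ℤ => (F (i.toNat + 1)).coeff i) := by
    refine ⟨min 0 (F 1).order, fun i hi => not_lt.mp fun hlt => hi ?_⟩
    beta_reduce
    rw [Int.toNat_of_nonpos (by omega), zero_add]
    exact HahnSeries.coeff_eq_zero_of_lt_order (by omega)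
  refine ⟨HahnSeries.ofSuppBddBelow _ hbdd, fun n => absVal_le_two_zpow_iff.mpr fun i hi => ?_⟩
  rw [HahnSeries.coeff_sub, HahnSeries.coeff_ofSuppBddBelow, sub_eq_zero]
  rcases le_total n (i.toNat + 1) with h | h
  · exact coeff_stable h hi
  · exact (coeff_stable h (by omega)).symm

end Valuation

section ContinuedFraction

variable {K : Type*} [Field K]

lemma two_le_absVal_polyEmb {a : K[X]} (ha : 1 ≤ a.natDegree) : 2 ≤ absVal (polyEmb a) := by
  rw [absVal_polyEmb (ne_zero_of_natDegree_gt ha)]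
  exact le_self_pow₀ (by norm_num) (by omega)

lemma ne_zero_of_two_le_absVal {F : LaurentSeries K} (h : 2 ≤ absVal F) : F ≠ 0 := by
  rintro rfl; rw [absVal_zero] at h; norm_num at h

lemma absVal_inv_lt_one {F : LaurentSeries K} (h : 2 ≤ absVal F) : absVal F⁻¹ < 1 := by
  rw [absVal_inv]; exact inv_lt_one_of_one_lt₀ (by linarith)

lemma absVal_inv_sub_inv_le {F G : LaurentSeries K} (hF : 2 ≤ absVal F) (hG : 2 ≤ absVal G) :
    absVal (F⁻¹ - G⁻¹) ≤ absVal (F - G) / 4 := by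
  rw [inv_sub_inv (ne_zero_of_two_le_absVal hF) (ne_zero_of_two_le_absVal hG), absVal_div,
    absVal_mul, absVal_sub_comm G F]
  exact div_le_div_of_nonneg_left (absVal_nonneg _) (by norm_num) (by nlinarith)

lemma absVal_polyEmb_add_inv {a : K[X]} (ha : 1 ≤ a.natDegree) {F : LaurentSeries K}
    (hF : 2 ≤ absVal F) : absVal (polyEmb a + F⁻¹) = absVal (polyEmb a) :=
  absVal_add_eq_left ((absVal_inv_lt_one hF).trans_le (by linarith [two_le_absVal_polyEmb ha]))

/-- The value `[a₀, …, aₙ₋₁, F]`. -/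
noncomputable def cfEval (l : List K[X]) (F : LaurentSeries K) : LaurentSeries K :=
  l.foldr (fun a G => polyEmb a + G⁻¹) F

@[simp] lemma cfEval_nil (F : LaurentSeries K) : cfEval [] F = F := rfl

@[simp] lemma cfEval_cons (a : K[X]) (l : List K[X]) (F : LaurentSeries K) :
    cfEval (a :: l) F = polyEmb a + (cfEval l F)⁻¹ := rfl

lemma cfEval_append (l₁ l₂ : List K[X]) (F : LaurentSeries K) :
    cfEval (l₁ ++ l₂) F = cfEval l₁ (cfEval l₂ F) := List.foldr_append

lemma two_le_absVal_cfEval {l : List K[X]} (hl : ∀ a ∈ l, 1 ≤ a.natDegree) {F : LaurentSeries K}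
    (hF : 2 ≤ absVal F) : 2 ≤ absVal (cfEval l F) := by
  induction l with
  | nil => exact hF
  | cons a l ih =>
    rw [List.forall_mem_cons] at hl
    rw [cfEval_cons, absVal_polyEmb_add_inv hl.1 (ih hl.2)]
    exact two_le_absVal_polyEmb hl.1

lemma absVal_cfEval_sub_le {l : List K[X]} (hl : ∀ a ∈ l, 1 ≤ a.natDegree)
    {F G : LaurentSeries K} (hF : 2 ≤ absVal F) (hG : 2 ≤ absVal G) :
    absVal (cfEval l F - cfEval l G) ≤ absVal (F - G) / 4 ^ l.length := by
  induction l with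
  | nil => simp
  | cons a l ih =>
    rw [List.forall_mem_cons] at hl
    rw [cfEval_cons, cfEval_cons, add_sub_add_left_eq_sub, List.length_cons, pow_succ, ← div_div]
    exact (absVal_inv_sub_inv_le (two_le_absVal_cfEval hl.2 hF)
      (two_le_absVal_cfEval hl.2 hG)).trans (by gcongr; exact ih hl.2)

lemma absVal_cfEval_sub_le_one {l : List K[X]} (hl : l ≠ []) (hdeg : ∀ a ∈ l, 1 ≤ a.natDegree)
    {F G : LaurentSeries K} (hF : 2 ≤ absVal F) (hG : 2 ≤ absVal G) :
    absVal (cfEval l F - cfEval l G) ≤ 1 := by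
  obtain ⟨a, l, rfl⟩ := List.exists_cons_of_ne_nil hl
  rw [List.forall_mem_cons] at hdeg
  rw [cfEval_cons, cfEval_cons, add_sub_add_left_eq_sub]
  exact (absVal_sub_le_max _ _).trans
    (max_le (absVal_inv_lt_one (two_le_absVal_cfEval hdeg.2 hF)).le
      (absVal_inv_lt_one (two_le_absVal_cfEval hdeg.2 hG)).le)

/- Two solutions of the same recursion differ by at most `1`, and each step of the recursion
divides the difference by at least `4`. -/
lemma eq_of_forall_eq_cfEval {l : ℕ → List K[X]} (hl : ∀ k, l k ≠ [])
    (hdeg : ∀ k, ∀ a ∈ l k, 1 ≤ a.natDegree) {F G : ℕ → LaurentSeries K}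
    (hF : ∀ k, 2 ≤ absVal (F k)) (hG : ∀ k, 2 ≤ absVal (G k))
    (hFl : ∀ k, F k = cfEval (l k) (F (k + 1))) (hGl : ∀ k, G k = cfEval (l k) (G (k + 1)))
    (k : ℕ) : F k = G k := by
  refine eq_of_forall_absVal_sub_le fun n => ?_
  induction n generalizing k with
  | zero =>
    rw [hFl, hGl, Nat.cast_zero, neg_zero, zpow_zero]
    exact absVal_cfEval_sub_le_one (hl k) (hdeg k) (hF _) (hG _)
  | succ n ih =>
    have hlen : (2 : ℝ) ≤ 4 ^ (l k).length :=
      le_trans (by norm_num) (le_self_pow₀ (by norm_num) (List.length_pos_iff.mpr (hl k)).ne')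
    rw [hFl, hGl, Nat.cast_succ, neg_add, zpow_add₀ (by norm_num), zpow_neg_one,
      ← div_eq_mul_inv]
    refine (absVal_cfEval_sub_le (hdeg k) (hF _) (hG _)).trans ?_
    exact div_le_div₀ (by positivity) (ih (k + 1)) (by norm_num) hlen

lemma completeQuotient_add (F : LaurentSeries K) (m n : ℕ) :
    completeQuotient F (m + n) = completeQuotient (completeQuotient F m) n := by
  induction n with
  | zero => rfl
  | succ n ih => rw [← add_assoc, completeQuotient, ih, completeQuotient]

namespace HasContFrac

variable {F G : LaurentSeries K} {a : ℕ → K[X]}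

lemma drop (h : HasContFrac F a) (m : ℕ) :
    HasContFrac (completeQuotient F m) fun n => a (m + n) := by
  intro n
  rw [← completeQuotient_add]
  exact h (m + n)

lemma completeQuotient_eq (h : HasContFrac F a) (n : ℕ) :
    completeQuotient F n = polyEmb (a n) + (completeQuotient F (n + 1))⁻¹ := by
  rw [← (h n).2, completeQuotient, inv_inv, polyEmb_polyPart_add_fracPart]

lemma completeQuotient_eq_cfEval (h : HasContFrac F a) (m : ℕ) {l : List K[X]}
    (hl : ∀ i (hi : i < l.length), l[i] = a (m + i)) :
    completeQuotient F m = cfEval l (completeQuotient F (m + l.length)) := by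
  induction l generalizing m with
  | nil => rfl
  | cons b l ih =>
    have hb : b = a m := hl 0 (Nat.succ_pos _)
    have htail := ih (m + 1) fun i hi => (hl (i + 1) (Nat.succ_lt_succ hi)).trans (by grind)
    rw [h.completeQuotient_eq, cfEval_cons, hb, htail, List.length_cons, add_right_comm, add_assoc]

lemma absVal_eq (h : HasContFrac F a) (ha : 1 ≤ (a 0).natDegree) :
    absVal F = absVal (polyEmb (a 0)) := by
  have hF : polyEmb (a 0) + fracPart F = F := (h 0).2 ▸ polyEmb_polyPart_add_fracPart F
  rw [← hF]
  exact absVal_add_eq_left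
    ((absVal_fracPart_lt_one F).trans_le (by linarith [two_le_absVal_polyEmb ha]))

lemma two_le_absVal (h : HasContFrac F a) (ha : 1 ≤ (a 0).natDegree) : 2 ≤ absVal F :=
  h.absVal_eq ha ▸ two_le_absVal_polyEmb ha

lemma unique (hF : HasContFrac F a) (hG : HasContFrac G a)
    (ha : ∀ n, 1 ≤ (a n).natDegree) : F = G :=
  eq_of_forall_eq_cfEval (l := fun k => [a k]) (F := completeQuotient F)
    (G := completeQuotient G) (by simp) (by simpa using ha)
    (fun k => (hF.drop k).two_le_absVal (ha k)) (fun k => (hG.drop k).two_le_absVal (ha k))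
    hF.completeQuotient_eq hG.completeQuotient_eq 0

lemma of_recursion {V : ℕ → LaurentSeries K}
    (hV : ∀ n, 2 ≤ absVal (V n)) (h : ∀ n, V n = polyEmb (a n) + (V (n + 1))⁻¹) :
    HasContFrac (V 0) a := by
  have hsub (n : ℕ) : V n - polyEmb (a n) = (V (n + 1))⁻¹ := sub_eq_of_eq_add' (h n)
  have hlt (n : ℕ) : absVal (V n - polyEmb (a n)) < 1 := by
    rw [hsub]; exact absVal_inv_lt_one (hV _)
  have hfrac (n : ℕ) : fracPart (V n) = (V (n + 1))⁻¹ := by rw [fracPart_eq (hlt n), hsub]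
  have hquot (n : ℕ) : completeQuotient (V 0) n = V n := by
    induction n with
    | zero => rfl
    | succ n ih => rw [completeQuotient, ih, hfrac, inv_inv]
  intro n
  rw [hquot, hfrac]
  exact ⟨inv_ne_zero (ne_zero_of_two_le_absVal (hV _)), polyPart_eq (hlt n)⟩

end HasContFrac

/-- The convergent `[a₀, …, aₙ]` of a continued fraction, as a series. -/
noncomputable def convergent (a : ℕ → K[X]) (n : ℕ) : LaurentSeries K :=
  cfEval ((List.range n).map a) (polyEmb (a n))

lemma convergent_succ (a : ℕ → K[X]) (n : ℕ) :
    convergent a (n + 1) =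
      cfEval ((List.range n).map a) (polyEmb (a n) + (polyEmb (a (n + 1)))⁻¹) := by
  rw [convergent, List.range_succ, List.map_append, cfEval_append]
  rfl

lemma convergent_succ' (a : ℕ → K[X]) (n : ℕ) :
    convergent a (n + 1) = polyEmb (a 0) + (convergent (fun i => a (i + 1)) n)⁻¹ := by
  rw [convergent, List.range_succ_eq_map, List.map_cons, List.map_map]
  rfl

section Convergents

variable {a : ℕ → K[X]} (ha : ∀ n, 1 ≤ (a n).natDegree)

include ha

lemma two_le_absVal_convergent (n : ℕ) : 2 ≤ absVal (convergent a n) :=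
  two_le_absVal_cfEval (List.forall_mem_map.mpr fun i _ => ha i) (two_le_absVal_polyEmb (ha n))

lemma absVal_convergent_succ_sub_le (n : ℕ) :
    absVal (convergent a (n + 1) - convergent a n) ≤ 2 ^ (-(n : ℤ)) := by
  have hn := two_le_absVal_polyEmb (ha n)
  have hn1 := two_le_absVal_polyEmb (ha (n + 1))
  rw [convergent_succ]
  refine (absVal_cfEval_sub_le (List.forall_mem_map.mpr fun i _ => ha i)
    (hn.trans_eq (absVal_polyEmb_add_inv (ha n) hn1).symm) hn).trans ?_
  rw [add_sub_cancel_left, List.length_map, List.length_range, zpow_neg, zpow_natCast,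
    inv_eq_one_div (2 ^ n : ℝ)]
  exact div_le_div₀ zero_le_one (absVal_inv_lt_one hn1).le (pow_pos two_pos n)
    (by gcongr; norm_num)

theorem exists_hasContFrac : ∃ F, HasContFrac F a := by
  have hlim (m : ℕ) : ∃ L, ∀ n : ℕ,
      absVal (L - convergent (fun i => a (i + m)) n) ≤ 2 ^ (-(n : ℤ)) :=
    exists_forall_absVal_sub_le (absVal_convergent_succ_sub_le fun _ => ha _)
  choose V hV using hlim
  have hconv (m n : ℕ) := two_le_absVal_convergent (a := fun i => a (i + m)) (fun _ => ha _) n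
  have hV2 (m : ℕ) : 2 ≤ absVal (V m) := by
    rw [← add_sub_cancel (convergent (fun i => a (i + m)) 0) (V m), absVal_add_eq_left]
    · exact hconv m 0
    · exact (hV m 0).trans_lt (lt_of_lt_of_le (by norm_num) (hconv m 0))
  refine ⟨V 0, HasContFrac.of_recursion hV2 fun m => eq_of_forall_absVal_sub_le fun n => ?_⟩
  set c := convergent (fun i => a (i + (m + 1))) n
  have hc : convergent (fun i => a (i + m)) (n + 1) = polyEmb (a m) + c⁻¹ := by
    rw [convergent_succ', zero_add]
    simp only [c, add_right_comm, add_assoc]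
  have hinv : absVal (c⁻¹ - (V (m + 1))⁻¹) ≤ 2 ^ (-(n : ℤ)) :=
    calc absVal (c⁻¹ - (V (m + 1))⁻¹) ≤ absVal (c - V (m + 1)) / 4 :=
          absVal_inv_sub_inv_le (hconv _ n) (hV2 _)
      _ ≤ absVal (c - V (m + 1)) := div_le_self (absVal_nonneg _) (by norm_num)
      _ ≤ 2 ^ (-(n : ℤ)) := absVal_sub_comm c _ ▸ hV (m + 1) n
  have hsplit : V m - (polyEmb (a m) + (V (m + 1))⁻¹) =
      (V m - convergent (fun i => a (i + m)) (n + 1)) + (c⁻¹ - (V (m + 1))⁻¹) := by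
    rw [hc]; ring
  rw [hsplit]
  refine (absVal_add_le_max _ _).trans (max_le ((hV m (n + 1)).trans ?_) hinv)
  exact zpow_le_zpow_right₀ (by norm_num) (by omega)

end Convergents

end ContinuedFraction

section Approximation

variable {K : Type*} [Field K]

/-- The matrix `Q` maps `F` to `G` as a fractional linear transformation. -/
def MobiusRel (Q : Matrix (Fin 2) (Fin 2) K[X]) (F G : LaurentSeries K) : Prop :=
  ∃ c ≠ 0, polyEmb (Q 0 0) * F + polyEmb (Q 0 1) = c * G ∧
    polyEmb (Q 1 0) * F + polyEmb (Q 1 1) = c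

lemma MobiusRel.comp {P Q : Matrix (Fin 2) (Fin 2) K[X]} {F G H : LaurentSeries K}
    (hP : MobiusRel P G H) (hQ : MobiusRel Q F G) : MobiusRel (P * Q) F H := by
  obtain ⟨c, hc, h1, h2⟩ := hP
  obtain ⟨d, hd, h3, h4⟩ := hQ
  refine ⟨c * d, mul_ne_zero hc hd, ?_, ?_⟩
  · simp only [Matrix.mul_apply, Fin.sum_univ_two, map_add, map_mul]
    linear_combination polyEmb (P 0 0) * h3 + polyEmb (P 0 1) * h4 + d * h1
  · simp only [Matrix.mul_apply, Fin.sum_univ_two, map_add, map_mul]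
    linear_combination polyEmb (P 1 0) * h3 + polyEmb (P 1 1) * h4 + d * h2

lemma MobiusRel.of_comp {P Q : Matrix (Fin 2) (Fin 2) K[X]} {F G H : LaurentSeries K}
    (hPQ : MobiusRel (P * Q) F H) (hQ : MobiusRel Q F G) : MobiusRel P G H := by
  obtain ⟨c, hc, h1, h2⟩ := hPQ
  obtain ⟨d, hd, h3, h4⟩ := hQ
  simp only [Matrix.mul_apply, Fin.sum_univ_two, map_add, map_mul] at h1 h2
  refine ⟨c / d, div_ne_zero hc hd, ?_, ?_⟩
  · field_simp
    linear_combination h1 - polyEmb (P 0 0) * h3 - polyEmb (P 0 1) * h4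
  · field_simp
    linear_combination h2 - polyEmb (P 1 0) * h3 - polyEmb (P 1 1) * h4

lemma MobiusRel.right_unique {Q : Matrix (Fin 2) (Fin 2) K[X]} {F G H : LaurentSeries K}
    (hG : MobiusRel Q F G) (hH : MobiusRel Q F H) : G = H := by
  obtain ⟨c, hc, h1, h2⟩ := hG
  obtain ⟨d, hd, h3, h4⟩ := hH
  obtain rfl : c = d := h2.symm.trans h4
  exact mul_left_cancel₀ hc (h1.symm.trans h3)

section cfMat

variable {R : Type*} [CommRing R]

/-- The matrix of the map `F ↦ a + 1 / F`. -/
def cfMat (a : R) : Matrix (Fin 2) (Fin 2) R := !![a, 1; 1, 0]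

/-- The matrix of the map `F ↦ [a₀, …, aₙ₋₁, F]`. Its bottom row holds the denominators of
`[a₀, …, aₙ₋₁]` and `[a₀, …, aₙ₋₂]`. -/
def cfMatProd (l : List R) : Matrix (Fin 2) (Fin 2) R := (l.map cfMat).prod

lemma cfMatProd_nil : cfMatProd ([] : List R) = 1 := rfl

lemma cfMatProd_cons (a : R) (l : List R) :
    cfMatProd (a :: l) = cfMat a * cfMatProd l := List.prod_cons

lemma cfMatProd_append (l l' : List R) :
    cfMatProd (l ++ l') = cfMatProd l * cfMatProd l' := by
  rw [cfMatProd, List.map_append, List.prod_append]; rfl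

lemma cfMatProd_flatten_replicate (l : List R) (n : ℕ) :
    cfMatProd (List.replicate n l).flatten = cfMatProd l ^ n := by
  induction n with
  | zero => rfl
  | succ n ih => rw [List.replicate_succ, List.flatten_cons, cfMatProd_append, ih, pow_succ']

lemma cfMatProd_concat_one_zero (l : List R) (a : R) :
    cfMatProd (l ++ [a]) 1 0 = cfMatProd l 1 0 * a + cfMatProd l 1 1 := by
  rw [cfMatProd_append]
  simp [cfMatProd, cfMat, Matrix.mul_apply, Fin.sum_univ_two]

lemma cfMatProd_concat_one_one (l : List R) (a : R) :
    cfMatProd (l ++ [a]) 1 1 = cfMatProd l 1 0 := by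
  rw [cfMatProd_append]
  simp [cfMatProd, cfMat, Matrix.mul_apply, Fin.sum_univ_two]

lemma det_cfMat (a : R) : (cfMat a).det = -1 := by simp [cfMat]

lemma det_cfMatProd (l : List R) : (cfMatProd l).det = (-1) ^ l.length := by
  induction l with
  | nil => simp [cfMatProd_nil]
  | cons a l ih =>
    rw [cfMatProd_cons, Matrix.det_mul, ih, det_cfMat, List.length_cons, pow_succ']

lemma natDegree_cfMatProd_le (l : List R[X]) (i j : Fin 2) :
    (cfMatProd l i j).natDegree ≤ (l.map natDegree).sum := by
  induction l generalizing i with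
  | nil => fin_cases i <;> fin_cases j <;> simp [cfMatProd_nil]
  | cons a l ih =>
    rw [cfMatProd_cons, Matrix.mul_apply, Fin.sum_univ_two, List.map_cons, List.sum_cons]
    fin_cases i
    · have h₀ : (a * cfMatProd l 0 j).natDegree ≤ a.natDegree + (l.map natDegree).sum :=
        natDegree_mul_le.trans (Nat.add_le_add_left (ih 0) _)
      simpa [cfMat] using natDegree_add_le_of_degree_le h₀ ((ih 1).trans (Nat.le_add_left _ _))
    · simpa [cfMat] using (ih 0).trans (Nat.le_add_left _ _)

lemma degree_cfMatProd_lt [NoZeroDivisors R] [Nontrivial R] {l : List R[X]} (hl : l ≠ [])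
    (hdeg : ∀ a ∈ l, 1 ≤ a.natDegree) :
    (cfMatProd l 1 1).degree < (cfMatProd l 1 0).degree := by
  induction l using List.reverseRecOn with
  | nil => exact absurd rfl hl
  | append_singleton l b ih =>
    simp only [List.mem_append, List.mem_singleton, or_imp, forall_and, forall_eq] at hdeg
    have hb : 0 < b.degree := natDegree_pos_iff_degree_pos.mp hdeg.2
    rw [cfMatProd_concat_one_one, cfMatProd_concat_one_zero]
    rcases eq_or_ne l [] with rfl | hne
    · simp [cfMatProd_nil]
    have hlt := ih hne hdeg.1
    have hmul : (cfMatProd l 1 0).degree < (cfMatProd l 1 0 * b).degree := by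
      have h0 : cfMatProd l 1 0 ≠ 0 := degree_ne_bot.mp (bot_le.trans_lt hlt).ne'
      rw [degree_mul, degree_eq_natDegree h0, degree_eq_natDegree (ne_zero_of_degree_gt hb)]
      exact_mod_cast Nat.lt_add_of_pos_right hdeg.2
    rwa [degree_add_eq_left_of_degree_lt (hlt.trans hmul)]

end cfMat

lemma mobiusRel_cfMat (a : K[X]) {F : LaurentSeries K} (hF : F ≠ 0) :
    MobiusRel (cfMat a) F (polyEmb a + F⁻¹) :=
  ⟨F, hF, by simp [cfMat, mul_add, hF, mul_comm], by simp [cfMat]⟩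

lemma mobiusRel_cfMatProd {l : List K[X]} (hl : ∀ a ∈ l, 1 ≤ a.natDegree) {F : LaurentSeries K}
    (hF : 2 ≤ absVal F) : MobiusRel (cfMatProd l) F (cfEval l F) := by
  induction l with
  | nil => exact ⟨1, one_ne_zero, by simp [cfMatProd_nil], by simp [cfMatProd_nil]⟩
  | cons a l ih =>
    rw [List.forall_mem_cons] at hl
    exact (mobiusRel_cfMat a (ne_zero_of_two_le_absVal (two_le_absVal_cfEval hl.2 hF))).comp
      (ih hl.2)

lemma MobiusRel.absVal_mul_fracNorm_le {Q : Matrix (Fin 2) (Fin 2) K[X]}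
    {F G : LaurentSeries K} (h : MobiusRel Q F G) (hQ : (Q 1 1).degree < (Q 1 0).degree)
    (hF : 1 ≤ absVal F) :
    absVal (polyEmb (Q 1 0)) * fracNorm (polyEmb (Q 1 0) * G) ≤
      absVal (polyEmb Q.det) / absVal F := by
  obtain ⟨c, -, hnum, hden⟩ := h
  have hlt := absVal_polyEmb_lt_iff.mpr hQ
  have hc : absVal c = absVal (polyEmb (Q 1 0)) * absVal F := by
    rw [← hden, absVal_add_eq_left] <;> rw [absVal_mul]
    exact hlt.trans_le (le_mul_of_one_le_right (absVal_nonneg _) hF)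
  have hdet : c * (polyEmb (Q 1 0) * G - polyEmb (Q 0 0)) = -polyEmb Q.det := by
    rw [Matrix.det_fin_two, map_sub, map_mul, map_mul]
    linear_combination -polyEmb (Q 1 0) * hnum + polyEmb (Q 0 0) * hden
  rw [le_div_iff₀ (zero_lt_one.trans_le hF), mul_right_comm, ← hc, ← absVal_neg (polyEmb Q.det),
    ← hdet, absVal_mul]
  exact mul_le_mul_of_nonneg_left (fracNorm_le _ _) (absVal_nonneg _)

lemma absVal_mul_fracNorm_cfEval_le_one {l : List K[X]} (hl : l ≠ [])
    (hdeg : ∀ a ∈ l, 1 ≤ a.natDegree) {F : LaurentSeries K} (hF : 2 ≤ absVal F) :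
    absVal (polyEmb (cfMatProd l 1 0)) * fracNorm (polyEmb (cfMatProd l 1 0) * cfEval l F) ≤ 1 := by
  have hF1 : 1 ≤ absVal F := one_le_two.trans hF
  refine ((mobiusRel_cfMatProd hdeg hF).absVal_mul_fracNorm_le (degree_cfMatProd_lt hl hdeg)
    hF1).trans ?_
  rw [det_cfMatProd, map_pow, map_neg, map_one, absVal_pow, absVal_neg, absVal_one, one_pow]
  exact div_le_one_of_le₀ hF1 (absVal_nonneg F)

namespace HasContFrac

variable {F : LaurentSeries K} {a : ℕ → K[X]}

lemma exists_inv_absVal_le (hF : HasContFrac F a) (ha : ∀ n, 1 ≤ (a n).natDegree) {q : K[X]}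
    (hq : q ≠ 0) (r : K[X]) :
    ∃ n, (absVal (polyEmb (a n)))⁻¹ ≤ absVal (polyEmb q) * absVal (polyEmb q * F - polyEmb r) := by
  induction hn : q.natDegree using Nat.strong_induction_on generalizing F a q r with
  | _ n ih =>
  subst hn
  set G := completeQuotient F 1
  have hG : HasContFrac G fun n => a (1 + n) := hF.drop 1
  have hG2 : 2 ≤ absVal G := hG.two_le_absVal (ha _)
  have hGpos : 0 < absVal G := two_pos.trans_le hG2
  have hFG : F = polyEmb (a 0) + G⁻¹ := hF.completeQuotient_eq 0
  set s := r - q * a 0 with hs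
  have hmul : absVal (polyEmb q * F - polyEmb r) * absVal G =
      absVal (polyEmb s * G - polyEmb q) := by
    have hG0 := ne_zero_of_two_le_absVal hG2
    rw [← absVal_mul, ← absVal_neg, hFG, hs, map_sub, map_mul]
    congr 1
    field_simp
    ring
  rw [← eq_div_iff hGpos.ne'] at hmul
  have hq1 := one_le_absVal_polyEmb hq
  rcases eq_or_ne s 0 with hs0 | hs0
  · refine ⟨1, ?_⟩
    rw [hmul, hs0, map_zero, zero_mul, zero_sub, absVal_neg, ← hG.absVal_eq (ha _), mul_div,
      inv_eq_one_div]
    gcongr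
    exact one_le_mul_of_one_le_of_one_le hq1 hq1
  rcases le_or_gt (absVal (polyEmb s * G)) (absVal (polyEmb q)) with hle | hgt
  · rw [absVal_mul] at hle
    have hlt : absVal (polyEmb s) < absVal (polyEmb q) := by
      nlinarith [one_le_absVal_polyEmb hs0]
    obtain ⟨n, hn⟩ := ih _ (natDegree_lt_natDegree hs0 (absVal_polyEmb_lt_iff.mp hlt)) hG
      (fun _ => ha _) hs0 q rfl
    refine ⟨1 + n, hn.trans ?_⟩
    rw [hmul, mul_div_left_comm, mul_comm]
    exact mul_le_mul_of_nonneg_left ((le_div_iff₀ hGpos).mpr hle) (absVal_nonneg _)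
  · refine ⟨0, (inv_le_one_of_one_le₀ (one_le_two.trans (two_le_absVal_polyEmb (ha 0)))).trans ?_⟩
    rw [hmul, sub_eq_add_neg, absVal_add_eq_left (by rwa [absVal_neg]), absVal_mul,
      mul_div_cancel_right₀ _ hGpos.ne']
    exact one_le_mul_of_one_le_of_one_le hq1 (one_le_absVal_polyEmb hs0)

lemma badlyApproximable (hF : HasContFrac F a) (ha : ∀ n, 1 ≤ (a n).natDegree) {d : ℕ}
    (hd : ∀ n, (a n).natDegree ≤ d) : BadlyApproximable F := by
  have : Nonempty {q : K[X] // q ≠ 0} := ⟨⟨1, one_ne_zero⟩⟩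
  refine (inv_pos.mpr (pow_pos two_pos d)).trans_le (le_ciInf fun q => ?_)
  obtain ⟨n, hn⟩ := hF.exists_inv_absVal_le ha q.2 (polyPart (polyEmb q.1 * F))
  refine le_trans ?_ hn
  rw [absVal_polyEmb (ne_zero_of_natDegree_gt (ha n))]
  exact inv_anti₀ (pow_pos two_pos _) (pow_le_pow_right₀ one_le_two (hd n))

lemma eq_zero_of_mul_eq (hF : HasContFrac F a) (ha : ∀ n, 1 ≤ (a n).natDegree) {q r : K[X]}
    (h : polyEmb q * F = polyEmb r) : q = 0 := by
  by_contra hq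
  obtain ⟨n, hn⟩ := hF.exists_inv_absVal_le ha hq r
  rw [h, sub_self, absVal_zero, mul_zero, inv_nonpos] at hn
  exact absurd (two_le_absVal_polyEmb (ha n)) (by linarith)

end HasContFrac

end Approximation

section BlockMatrices

variable {R : Type*} [CommRing R]

lemma mul_mul_mul_mul_eq_of_semiconjBy {M : Type*} [Semigroup M] {d e e' n n' q q' t u u' : M}
    (he : e * d = t * e') (hu : u * t = d * u') (hq : SemiconjBy d q' q)
    (hn : SemiconjBy t n' n) : e * q * u * n * t = t * (e' * q' * u' * n') :=
  calc e * q * u * n * t = e * q * (u * t) * n' := by simp only [mul_assoc, hn.eq]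
    _ = e * (d * q') * u' * n' := by rw [hu, hq.eq]; simp only [mul_assoc]
    _ = (e * d) * q' * u' * n' := by simp only [mul_assoc]
    _ = t * (e' * q' * u' * n') := by rw [he]; simp only [mul_assoc]

lemma mapMatrix_cfMatProd {S : Type*} [CommRing S] (f : R →+* S) (l : List R) :
    f.mapMatrix (cfMatProd l) = cfMatProd (l.map f) := by
  have hcfMat (a : R) : f.mapMatrix (cfMat a) = cfMat (f a) := by
    ext i j : 1
    fin_cases i <;> fin_cases j <;> simp [cfMat]
  induction l with
  | nil => exact map_one _
  | cons a l ih => rw [List.map_cons, cfMatProd_cons, cfMatProd_cons, map_mul, hcfMat, ih]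

/-- Conjugation by the diagonal matrix `diag(1, t)`, whose inverse is `diag(1, s)`. -/
def diagConj {s t : R} (hst : s * t = 1) :
    Matrix (Fin 2) (Fin 2) R →* Matrix (Fin 2) (Fin 2) R where
  toFun Q := !![Q 0 0, s * Q 0 1; t * Q 1 0, Q 1 1]
  map_one' := by
    ext i j : 1
    fin_cases i <;> fin_cases j <;> simp
  map_mul' P Q := by
    ext i j : 1
    fin_cases i <;> fin_cases j <;> simp [Matrix.mul_apply, Fin.sum_univ_two]
    · linear_combination -P 0 1 * Q 1 0 * hst
    · ring
    · ring
    · linear_combination -P 1 0 * Q 0 1 * hst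

lemma diagConj_apply {s t : R} (hst : s * t = 1) (Q : Matrix (Fin 2) (Fin 2) R) :
    diagConj hst Q = !![Q 0 0, s * Q 0 1; t * Q 1 0, Q 1 1] := rfl

lemma cfMatProd_flatten_replicate_pair {s t : R} (hst : s * t = 1) (x : R) (n : ℕ) :
    cfMatProd (List.replicate n [s * x, t * x]).flatten = diagConj hst (cfMat x ^ (2 * n)) := by
  have hpair : cfMatProd [s * x, t * x] = diagConj hst (cfMat x ^ 2) := by
    rw [cfMatProd_cons, cfMatProd_cons, cfMatProd_nil, mul_one, map_pow, pow_two]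
    ext i j : 1
    fin_cases i <;> fin_cases j <;>
      simp [cfMat, diagConj_apply, Matrix.mul_apply, Fin.sum_univ_two] <;> grind
  rw [cfMatProd_flatten_replicate, hpair, pow_mul, map_pow _ (cfMat x ^ 2)]

lemma neg_one_mul_neg_one (R : Type*) [CommRing R] : (-1 : R) * -1 = 1 := by simp

/-- The word `x, (s x, 3 x)ⁿ, -s x, (-x, -x)ⁿ`. For `s = 1 / 3`, `x = X` and
`n = (p ^ k - 1) / 2` it is the word `thetaBlock p k`. -/
def blockWord (s x : R) (n : ℕ) : List R :=
  x :: ((List.replicate n [s * x, 3 * x]).flatten ++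
    (-(s * x)) :: (List.replicate n [-x, -x]).flatten)

lemma map_blockWord {S : Type*} [CommRing S] (f : R →+* S) (s x : R) (n : ℕ) :
    (blockWord s x n).map f = blockWord (f s) (f x) n := by
  simp [blockWord, List.map_flatten, map_ofNat f 3]

lemma mem_of_mem_blockWord {s x a : R} {n : ℕ} (ha : a ∈ blockWord s x n) :
    a ∈ [x, s * x, 3 * x, -(s * x), -x] := by
  simp only [blockWord, List.mem_cons, List.mem_append, List.mem_flatten, List.mem_replicate]
    at ha ⊢
  grind

variable {s x : R} (hs : s * 3 = 1)

include hs

/- Completing the two subwords `(s x, 3 x)ⁿ` and `(-x, -x)ⁿ` by half a period turns the matrix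
exponent `2 n = p ^ k - 1` into `2 n + 1 = p ^ k`, which the Frobenius can handle. -/
lemma cfMatProd_blockWord (n : ℕ) :
    cfMatProd (blockWord s x n) =
      !![3, -2 * s * x; 0, s] * diagConj hs (cfMat x ^ (2 * n + 1)) *
        !![-1, -2 * s * x; 0, -1] *
          diagConj (neg_one_mul_neg_one R) (cfMat x ^ (2 * n + 1)) := by
  have hneg := neg_one_mul_neg_one R
  have hfst : cfMat x = !![3, -2 * s * x; 0, s] * diagConj hs (cfMat x) := by
    ext i j : 1
    fin_cases i <;> fin_cases j <;>
      simp [cfMat, diagConj_apply, Matrix.mul_apply, Fin.sum_univ_two] <;> grind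
  have hsnd : cfMat (-(s * x)) = !![-1, -2 * s * x; 0, -1] * diagConj hneg (cfMat x) := by
    ext i j : 1
    fin_cases i <;> fin_cases j <;>
      simp [cfMat, diagConj_apply, Matrix.mul_apply, Fin.sum_univ_two]
    grind
  have hword := cfMatProd_flatten_replicate_pair hneg x n
  rw [neg_one_mul] at hword
  rw [blockWord, cfMatProd_cons, cfMatProd_append, cfMatProd_cons,
    cfMatProd_flatten_replicate_pair hs, hword, hsnd, pow_succ', map_mul, map_mul]
  nth_rw 1 [hfst]
  simp only [mul_assoc]

lemma cfMatProd_blockWord_mul {y g h : R} (hy : y = x * g + 2 * h) {m n : ℕ}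
    (hsemi : SemiconjBy !![1, -h; 0, g] (cfMat y ^ (2 * n + 1)) (cfMat x ^ (2 * m + 1))) :
    cfMatProd (blockWord s x m) * !![1, h; 0, g] =
      !![1, h; 0, g] * cfMatProd (blockWord s y n) := by
  have hneg := neg_one_mul_neg_one R
  have hthree := hsemi.map (diagConj hs)
  have hminus := hsemi.map (diagConj hneg)
  have hT : diagConj hneg !![1, -h; 0, g] = !![1, h; 0, g] := by simp [diagConj_apply]
  have hfst : !![3, -2 * s * x; 0, s] * diagConj hs !![1, -h; 0, g] =
      !![1, h; 0, g] * !![3, -2 * s * y; 0, s] := by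
    rw [diagConj_apply]
    ext i j : 1
    fin_cases i <;> fin_cases j <;> simp [Matrix.mul_apply, Fin.sum_univ_two] <;> grind
  have hsnd : !![-1, -2 * s * x; 0, -1] * !![1, h; 0, g] =
      diagConj hs !![1, -h; 0, g] * !![-1, -2 * s * y; 0, -1] := by
    rw [diagConj_apply]
    ext i j : 1
    fin_cases i <;> fin_cases j <;> simp [Matrix.mul_apply, Fin.sum_univ_two]
    grind
  rw [hT] at hminus
  rw [cfMatProd_blockWord hs, cfMatProd_blockWord hs]
  exact mul_mul_mul_mul_eq_of_semiconjBy hfst hsnd hthree hminus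

end BlockMatrices

section MillsRobbins

variable (p : ℕ) [Fact p.Prime]

lemma mrF_eq_sum_range_succ (k : ℕ) :
    mrF p k = ∑ j ∈ Finset.range (k + 1),
      C (((k - j).choose j : ℕ) : ZMod p) * X ^ (k - 2 * j) := by
  rw [mrF]
  refine Finset.sum_subset (Finset.range_subset_range.2 (by omega)) fun j _ hj => ?_
  rw [Finset.mem_range] at hj
  rw [Nat.choose_eq_zero_of_lt (by omega), Nat.cast_zero, C_0, zero_mul]

lemma mrF_zero : mrF p 0 = 1 := by simp [mrF]

lemma mrF_one : mrF p 1 = X := by simp [mrF]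

lemma mrF_add_two (k : ℕ) : mrF p (k + 2) = X * mrF p (k + 1) + mrF p k := by
  have hpascal : ∀ i ∈ Finset.range (k + 1),
      C (((k + 2 - (i + 1)).choose (i + 1) : ℕ) : ZMod p) * X ^ (k + 2 - 2 * (i + 1)) =
      X * (C (((k + 1 - (i + 1)).choose (i + 1) : ℕ) : ZMod p) * X ^ (k + 1 - 2 * (i + 1))) +
      C (((k - i).choose i : ℕ) : ZMod p) * X ^ (k - 2 * i) := by
    intro i hi
    rw [Finset.mem_range] at hi
    rw [show k + 2 - (i + 1) = (k - i) + 1 by omega, Nat.choose_succ_succ,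
      show k + 1 - (i + 1) = k - i by omega, show k + 2 - 2 * (i + 1) = k - 2 * i by omega,
      Nat.cast_add, C_add]
    by_cases h2 : 2 * i < k
    · rw [show k - 2 * i = (k + 1 - 2 * (i + 1)) + 1 by omega, pow_succ]
      ring
    · rw [Nat.choose_eq_zero_of_lt (show k - i < i + 1 by omega)]
      simp
  rw [mrF_eq_sum_range_succ p (k + 2), mrF_eq_sum_range_succ p (k + 1),
    mrF_eq_sum_range_succ p k, Finset.sum_range_succ' _ (k + 2), Finset.sum_range_succ _ (k + 1),
    Finset.sum_range_succ' _ (k + 1), mul_add X, Finset.mul_sum, Finset.sum_congr rfl hpascal,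
    Finset.sum_add_distrib]
  simp [pow_succ]
  ring

lemma isMonicOfDegree_mrF (k : ℕ) : IsMonicOfDegree (mrF p k) k := by
  induction k using Nat.twoStepInduction with
  | zero => rw [mrF_zero]; exact isMonicOfDegree_zero_iff.2 rfl
  | one => rw [mrF_one]; exact isMonicOfDegree_X _
  | more k hk hk1 =>
    rw [mrF_add_two]
    refine IsMonicOfDegree.add_right ?_ (hk.natDegree_eq.trans_lt (by omega))
    rw [show k + 2 = 1 + (k + 1) by omega]
    exact (isMonicOfDegree_X _).mul hk1

lemma cfMat_X_pow (n : ℕ) : (cfMat X : Matrix (Fin 2) (Fin 2) (ZMod p)[X]) ^ (n + 2) =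
    !![mrF p (n + 2), mrF p (n + 1); mrF p (n + 1), mrF p n] := by
  induction n with
  | zero => simp [mrF_add_two, mrF_one, mrF_zero, cfMat, pow_two]
  | succ n ih =>
    rw [pow_succ', ih, mrF_add_two p (n + 1), mrF_add_two p n]
    simp [cfMat]

lemma cfMat_X_pow_char : (cfMat X : Matrix (Fin 2) (Fin 2) (ZMod p)[X]) ^ p =
    !![X * mrF p (p - 1) + mrF p (p - 2), mrF p (p - 1); mrF p (p - 1), mrF p (p - 2)] := by
  obtain ⟨n, rfl⟩ := Nat.exists_eq_add_of_le' (Fact.out : p.Prime).two_le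
  exact (cfMat_X_pow _ n).trans (by rw [mrF_add_two]; rfl)

lemma cfMat_sq {R : Type*} [CommRing R] (a : R) : cfMat a ^ 2 = a • cfMat a + 1 := by
  simp [cfMat, pow_two, Matrix.one_fin_two, Matrix.smul_of]

/- The `p`-th power of the characteristic equation `A² = X A + 1` of `A = cfMat X`. -/
lemma cfMat_X_pow_char_sq : (cfMat (X : (ZMod p)[X]) ^ p) ^ 2 =
    (X ^ p : (ZMod p)[X]) • cfMat (X : (ZMod p)[X]) ^ p + 1 := by
  rw [← pow_mul, mul_comm, pow_mul, cfMat_sq, add_pow_char_of_commute _ (Commute.one_right _),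
    one_pow, _root_.smul_pow]

lemma X_pow_char_eq :
    (X : (ZMod p)[X]) ^ p = X * mrF p (p - 1) + 2 * mrF p (p - 2) := by
  have hsq := congrFun (congrFun (cfMat_X_pow_char_sq p) 0) 1
  simp only [cfMat_X_pow_char, pow_two, Matrix.mul_apply, Fin.sum_univ_two, Matrix.add_apply,
    Matrix.smul_apply, Matrix.of_apply, Matrix.cons_val_zero, Matrix.cons_val_one,
    Matrix.one_apply_ne zero_ne_one, smul_eq_mul, add_zero] at hsq
  apply mul_right_cancel₀ (isMonicOfDegree_mrF p (p - 1)).ne_zero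
  linear_combination -hsq

lemma mrF_sq_sub_mul_sub_sq :
    mrF p (p - 1) ^ 2 - X * mrF p (p - 1) * mrF p (p - 2) - mrF p (p - 2) ^ 2 = 1 := by
  have hdet := congrArg Matrix.det (cfMat_X_pow_char p)
  rw [Matrix.det_pow, det_cfMat, neg_one_pow_char, Matrix.det_fin_two_of] at hdet
  linear_combination hdet

lemma semiconjBy_cfMat_X_pow_char : SemiconjBy !![1, -mrF p (p - 2); 0, mrF p (p - 1)]
    (cfMat (X ^ p)) (cfMat X ^ p) := by
  rw [SemiconjBy, cfMat_X_pow_char, X_pow_char_eq, cfMat]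
  ext i j : 1
  fin_cases i <;> fin_cases j <;> simp [Matrix.mul_apply, Fin.sum_univ_two]
  · ring
  · linear_combination -mrF_sq_sub_mul_sub_sq p
  · ring

variable {p}

lemma three_ne_zero_zmod (hp : 5 ≤ p) : (3 : ZMod p) ≠ 0 := by
  have h : ¬p ∣ 3 := fun h => absurd (Nat.le_of_dvd (by norm_num) h) (by omega)
  exact_mod_cast (ZMod.natCast_eq_zero_iff 3 p).not.2 h

lemma C_three_inv_mul_three (hp : 5 ≤ p) : C (3 : ZMod p)⁻¹ * 3 = 1 := by
  rw [← map_ofNat C 3, ← C_mul, inv_mul_cancel₀ (three_ne_zero_zmod hp), C_1]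

lemma polyEmb_C_three_inv_mul_three (hp : 5 ≤ p) : polyEmb (C (3 : ZMod p)⁻¹) * 3 = 1 := by
  rw [← map_ofNat polyEmb 3, ← map_mul, C_three_inv_mul_three hp, map_one]

variable (p) in
lemma thetaBlock_eq_blockWord (k : ℕ) :
    thetaBlock p k = blockWord (C (3 : ZMod p)⁻¹) X ((p ^ k - 1) / 2) := rfl

lemma cfMatProd_thetaBlock_succ_mul (hp : 5 ≤ p) (k : ℕ) :
    cfMatProd (thetaBlock p (k + 1)) * !![1, mrF p (p - 2); 0, mrF p (p - 1)] =
      !![1, mrF p (p - 2); 0, mrF p (p - 1)] *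
        cfMatProd ((thetaBlock p k).map (frobenius (ZMod p)[X] p)) := by
  have hodd (j : ℕ) : 2 * ((p ^ j - 1) / 2) + 1 = p ^ j := by
    obtain ⟨m, hm⟩ := ((Fact.out : p.Prime).odd_of_ne_two (by omega)).pow (n := j)
    omega
  have hC : frobenius (ZMod p)[X] p (C (3 : ZMod p)⁻¹) = C (3 : ZMod p)⁻¹ := by
    rw [frobenius_def, ← C_pow, ZMod.pow_card]
  rw [thetaBlock_eq_blockWord, thetaBlock_eq_blockWord, map_blockWord, hC, frobenius_def]
  refine cfMatProd_blockWord_mul (C_three_inv_mul_three hp) (X_pow_char_eq p) ?_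
  rw [hodd, hodd, pow_succ', pow_mul]
  exact (semiconjBy_cfMat_X_pow_char p).pow_right (p ^ k)

end MillsRobbins

section ThetaSeries

variable {p : ℕ}

section Frobenius

variable {K : Type*} [Field K] [CharP K p]

instance charP_laurentSeries : CharP (LaurentSeries K) p :=
  charP_of_injective_ringHom polyEmb_injective p

lemma MobiusRel.frobenius [Fact p.Prime] {l : List K[X]} {F G : LaurentSeries K}
    (h : MobiusRel (cfMatProd l) F G) :
    MobiusRel (cfMatProd (l.map (frobenius K[X] p))) (F ^ p) (G ^ p) := by
  obtain ⟨c, hc, hnum, hden⟩ := h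
  rw [← mapMatrix_cfMatProd]
  refine ⟨c ^ p, pow_ne_zero _ hc, ?_, ?_⟩
  · simp only [RingHom.mapMatrix_apply, Matrix.map_apply, frobenius_def, map_pow]
    rw [← mul_pow, ← add_pow_char, hnum, mul_pow]
  · simp only [RingHom.mapMatrix_apply, Matrix.map_apply, frobenius_def, map_pow]
    rw [← mul_pow, ← add_pow_char, hden]

end Frobenius

variable [Fact p.Prime]

section Words

variable (p)

/-- The concatenation of the blocks with index less than `k`. -/
noncomputable def thetaPrefix (k : ℕ) : List (ZMod p)[X] := (List.range k).flatMap (thetaBlock p)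

lemma thetaPrefix_succ (k : ℕ) : thetaPrefix p (k + 1) = thetaPrefix p k ++ thetaBlock p k := by
  simp [thetaPrefix, List.range_succ]

lemma thetaPrefix_isPrefix {k m : ℕ} (h : k ≤ m) : thetaPrefix p k <+: thetaPrefix p m := by
  induction m, h using Nat.le_induction with
  | base => exact List.prefix_rfl
  | succ m _ ih => exact ih.trans (thetaPrefix_succ p m ▸ List.prefix_append _ _)

lemma length_thetaBlock (k : ℕ) :
    (thetaBlock p k).length = 2 + 4 * ((p ^ k - 1) / 2) := by
  simp only [thetaBlock, wordLThree, wordLNegOne, List.length_cons, List.length_append,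
    List.length_flatten, List.map_replicate, List.length_nil, List.sum_replicate, smul_eq_mul]
  omega

lemma two_mul_le_length_thetaPrefix (k : ℕ) : 2 * k ≤ (thetaPrefix p k).length := by
  induction k with
  | zero => exact Nat.zero_le _
  | succ k ih => rw [thetaPrefix_succ, List.length_append, length_thetaBlock]; omega

lemma lt_length_thetaPrefix_succ (n : ℕ) : n < (thetaPrefix p (n + 1)).length := by
  have := two_mul_le_length_thetaPrefix p (n + 1)
  omega

lemma thetaPrefix_getElem {k n : ℕ} (h : n < (thetaPrefix p k).length) :
    (thetaPrefix p k)[n] = thetaQuotients p n := by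
  have hn := lt_length_thetaPrefix_succ p n
  rw [thetaQuotients, ← thetaPrefix, List.getD_eq_getElem _ _ hn]
  rcases le_total k (n + 1) with hk | hk
  · exact (thetaPrefix_isPrefix p hk).getElem h
  · exact ((thetaPrefix_isPrefix p hk).getElem hn).symm

lemma thetaBlock_getElem {k i : ℕ} (hi : i < (thetaBlock p k).length) :
    (thetaBlock p k)[i] = thetaQuotients p ((thetaPrefix p k).length + i) := by
  have h : (thetaPrefix p k).length + i < (thetaPrefix p (k + 1)).length := by
    rw [thetaPrefix_succ, List.length_append]
    omega
  rw [← thetaPrefix_getElem p h]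
  simp [thetaPrefix_succ]

end Words

lemma natDegree_xDivThree (hp : 5 ≤ p) : (xDivThree p).natDegree = 1 :=
  natDegree_C_mul_X _ (inv_ne_zero (three_ne_zero_zmod hp))

lemma natDegree_three_mul_X (hp : 5 ≤ p) : (3 * X : (ZMod p)[X]).natDegree = 1 := by
  rw [← map_ofNat C 3]
  exact natDegree_C_mul_X _ (three_ne_zero_zmod hp)

lemma natDegree_of_mem_thetaBlock (hp : 5 ≤ p) {k : ℕ} {a : (ZMod p)[X]}
    (ha : a ∈ thetaBlock p k) : a.natDegree = 1 := by
  have hdiv := natDegree_xDivThree hp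
  have hmul := natDegree_three_mul_X hp
  rw [xDivThree] at hdiv
  rw [thetaBlock_eq_blockWord] at ha
  have hmem := mem_of_mem_blockWord ha
  simp only [List.mem_cons, List.not_mem_nil, or_false] at hmem
  rcases hmem with rfl | rfl | rfl | rfl | rfl <;>
    simp only [natDegree_neg, natDegree_X, hdiv, hmul]

lemma natDegree_of_mem_thetaPrefix (hp : 5 ≤ p) {k : ℕ} {a : (ZMod p)[X]}
    (ha : a ∈ thetaPrefix p k) : a.natDegree = 1 := by
  obtain ⟨j, _, hj⟩ := List.mem_flatMap.1 ha
  exact natDegree_of_mem_thetaBlock hp hj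

lemma natDegree_thetaQuotients (hp : 5 ≤ p) (n : ℕ) : (thetaQuotients p n).natDegree = 1 := by
  rw [← thetaPrefix_getElem p (lt_length_thetaPrefix_succ p n)]
  exact natDegree_of_mem_thetaPrefix hp (List.getElem_mem _)

section FrobStep

/-- The map `F ↦ (F ^ p + f_(p-2)) / f_(p-1)`, which will turn out to delete the first block of the
continued fraction of `Θ`. -/
noncomputable def frobStep (F : LaurentSeries (ZMod p)) : LaurentSeries (ZMod p) :=
  (F ^ p + polyEmb (mrF p (p - 2))) / polyEmb (mrF p (p - 1))

variable (F : LaurentSeries (ZMod p))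

lemma frobStep_mul_mrF :
    frobStep F * polyEmb (mrF p (p - 1)) = F ^ p + polyEmb (mrF p (p - 2)) :=
  div_mul_cancel₀ _ (polyEmb_ne_zero (isMonicOfDegree_mrF p (p - 1)).ne_zero)

lemma mobiusRel_frobStep :
    MobiusRel !![1, mrF p (p - 2); 0, mrF p (p - 1)] (F ^ p) (frobStep F) := by
  refine ⟨polyEmb (mrF p (p - 1)), polyEmb_ne_zero (isMonicOfDegree_mrF p (p - 1)).ne_zero, ?_, ?_⟩
  · simp [mul_comm _ (frobStep F), frobStep_mul_mrF]
  · simp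

variable {F}

lemma absVal_frobStep (hF : absVal F = 2) : absVal (frobStep F) = 2 := by
  have hp := (Fact.out : p.Prime).two_le
  have hf (k : ℕ) : absVal (polyEmb (mrF p k)) = 2 ^ k := by
    rw [absVal_polyEmb (isMonicOfDegree_mrF p k).ne_zero, (isMonicOfDegree_mrF p k).natDegree_eq]
  have hlt : absVal (polyEmb (mrF p (p - 2))) < absVal (F ^ p) := by
    rw [hf, absVal_pow, hF]
    exact pow_lt_pow_right₀ one_lt_two (by omega)
  rw [frobStep, absVal_div, absVal_add_eq_left hlt, hf, absVal_pow, hF,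
    div_eq_iff (by positivity), ← pow_succ', Nat.sub_add_cancel (by omega)]

lemma MobiusRel.frobStep (hp : 5 ≤ p) {k : ℕ} {G : LaurentSeries (ZMod p)}
    (h : MobiusRel (cfMatProd (thetaBlock p k)) F G) :
    MobiusRel (cfMatProd (thetaBlock p (k + 1))) (frobStep F) (frobStep G) := by
  have hcomp := (mobiusRel_frobStep G).comp (h.frobenius (p := p))
  rw [← cfMatProd_thetaBlock_succ_mul hp k] at hcomp
  exact hcomp.of_comp (mobiusRel_frobStep F)

end FrobStep

/-- The complete quotient of `Θ` at the start of the block with index `k`. -/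
noncomputable def thetaTail (Θ : LaurentSeries (ZMod p)) (k : ℕ) : LaurentSeries (ZMod p) :=
  completeQuotient Θ (thetaPrefix p k).length

variable {Θ : LaurentSeries (ZMod p)}

lemma thetaTail_zero : thetaTail Θ 0 = Θ := rfl

lemma eq_cfEval_thetaTail (hΘ : HasContFrac Θ (thetaQuotients p)) (k : ℕ) :
    Θ = cfEval (thetaPrefix p k) (thetaTail Θ k) := by
  have h := hΘ.completeQuotient_eq_cfEval 0 (l := thetaPrefix p k)
    fun i hi => (thetaPrefix_getElem p hi).trans (by rw [zero_add])
  rwa [zero_add] at h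

lemma thetaTail_eq_cfEval (hΘ : HasContFrac Θ (thetaQuotients p)) (k : ℕ) :
    thetaTail Θ k = cfEval (thetaBlock p k) (thetaTail Θ (k + 1)) := by
  rw [thetaTail, thetaTail, thetaPrefix_succ, List.length_append]
  exact hΘ.completeQuotient_eq_cfEval _ fun i => thetaBlock_getElem p

lemma absVal_thetaTail (hp : 5 ≤ p) (hΘ : HasContFrac Θ (thetaQuotients p)) (k : ℕ) :
    absVal (thetaTail Θ k) = 2 := by
  have hdeg := natDegree_thetaQuotients hp (thetaPrefix p k).length
  rw [thetaTail, (hΘ.drop _).absVal_eq hdeg.ge, add_zero,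
    absVal_polyEmb (ne_zero_of_natDegree_gt hdeg.ge), hdeg, pow_one]

lemma frobStep_thetaTail_eq_cfEval (hp : 5 ≤ p) (hΘ : HasContFrac Θ (thetaQuotients p)) (k : ℕ) :
    frobStep (thetaTail Θ k) =
      cfEval (thetaBlock p (k + 1)) (frobStep (thetaTail Θ (k + 1))) := by
  have hblock (k : ℕ) : ∀ a ∈ thetaBlock p k, 1 ≤ a.natDegree := fun a ha =>
    (natDegree_of_mem_thetaBlock hp ha).ge
  have htail := absVal_thetaTail hp hΘ (k + 1)
  have hrel := mobiusRel_cfMatProd (hblock k) htail.ge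
  rw [← thetaTail_eq_cfEval hΘ k] at hrel
  exact (hrel.frobStep hp).right_unique
    (mobiusRel_cfMatProd (hblock (k + 1)) (absVal_frobStep htail).ge)

theorem frobStep_thetaTail (hp : 5 ≤ p) (hΘ : HasContFrac Θ (thetaQuotients p)) (k : ℕ) :
    frobStep (thetaTail Θ k) = thetaTail Θ (k + 1) :=
  eq_of_forall_eq_cfEval (l := fun k => thetaBlock p (k + 1))
    (F := fun k => frobStep (thetaTail Θ k)) (G := fun k => thetaTail Θ (k + 1))
    (fun _ => List.cons_ne_nil _ _) (fun _ _ ha => (natDegree_of_mem_thetaBlock hp ha).ge)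
    (fun k => (absVal_frobStep (absVal_thetaTail hp hΘ k)).ge)
    (fun k => (absVal_thetaTail hp hΘ (k + 1)).ge) (frobStep_thetaTail_eq_cfEval hp hΘ)
    (fun k => thetaTail_eq_cfEval hΘ (k + 1)) k

lemma sub_mul_thetaTail_one (hp : 5 ≤ p) (hΘ : HasContFrac Θ (thetaQuotients p)) :
    (polyEmb X * Θ - (polyEmb X ^ 2 - 3)) * thetaTail Θ 1 = 3 * (Θ - polyEmb X) := by
  have hblock : thetaBlock p 0 = [X, -xDivThree p] := by
    simp [thetaBlock, wordLThree, wordLNegOne]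
  have hT := (absVal_thetaTail hp hΘ 1).ge
  have hU : 2 ≤ absVal (cfEval [-xDivThree p] (thetaTail Θ 1)) :=
    two_le_absVal_cfEval (by simp [natDegree_xDivThree hp]) hT
  have hΘU : Θ = polyEmb X + (cfEval [-xDivThree p] (thetaTail Θ 1))⁻¹ := by
    conv_lhs => rw [← thetaTail_zero (Θ := Θ), thetaTail_eq_cfEval hΘ 0, hblock, cfEval_cons]
  have hsub : (Θ - polyEmb X) * cfEval [-xDivThree p] (thetaTail Θ 1) = 1 := by
    rw [sub_eq_of_eq_add' hΘU, inv_mul_cancel₀ (ne_zero_of_two_le_absVal hU)]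
  rw [cfEval_cons, cfEval_nil, map_neg, xDivThree, map_mul] at hsub
  have hinv := inv_mul_cancel₀ (ne_zero_of_two_le_absVal hT)
  linear_combination (-3 * thetaTail Θ 1) * hsub + 3 * (Θ - polyEmb X) * hinv
    - (Θ - polyEmb X) * polyEmb X * thetaTail Θ 1 * polyEmb_C_three_inv_mul_three hp

theorem mrPoly_eval (hp : 5 ≤ p) (hΘ : HasContFrac Θ (thetaQuotients p)) :
    (mrPoly p).eval₂ polyEmb Θ = 0 := by
  have hstep : thetaTail Θ 1 * polyEmb (mrF p (p - 1)) = Θ ^ p + polyEmb (mrF p (p - 2)) :=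
    frobStep_thetaTail hp hΘ 0 ▸ frobStep_mul_mrF Θ
  have hblock := sub_mul_thetaTail_one hp hΘ
  simp only [mrPoly, eval₂_add, eval₂_sub, eval₂_mul, eval₂_C, eval₂_pow, eval₂_X]
  simp only [map_add, map_sub, map_mul, map_neg, map_pow, map_ofNat]
  linear_combination polyEmb (mrF p (p - 1)) * hblock
    - (polyEmb X * Θ - (polyEmb X ^ 2 - 3)) * hstep

end ThetaSeries

section DenomError

variable {K : Type*} [Field K]

/-- The deviation `Q₁₀ - F Q₁₁` of the last two denominators of the word `l` from the ratio `F`.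
It is small when `F` has the reversal of `l` as the beginning of its continued fraction. -/
noncomputable def denomError (F : LaurentSeries K) (l : List K[X]) : LaurentSeries K :=
  polyEmb (cfMatProd l 1 0) - F * polyEmb (cfMatProd l 1 1)

lemma absVal_denomError_concat (b : K[X]) {F : LaurentSeries K} (hF : F ≠ 0) (l : List K[X]) :
    absVal (denomError (polyEmb b + F⁻¹) (l ++ [b])) = absVal (denomError F l) / absVal F := by
  have hconcat : denomError (polyEmb b + F⁻¹) (l ++ [b]) = -(denomError F l / F) := by
    rw [denomError, denomError, cfMatProd_concat_one_zero, cfMatProd_concat_one_one, map_add,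
      map_mul]
    field_simp
    ring
  rw [hconcat, absVal_neg, absVal_div]

lemma absVal_denomError_le {F : LaurentSeries K} (hF : 1 ≤ absVal F) (l : List K[X]) :
    absVal (denomError F l) ≤ absVal F * 2 ^ (l.map natDegree).sum := by
  have hentry (j : Fin 2) : absVal (polyEmb (cfMatProd l 1 j)) ≤ 2 ^ (l.map natDegree).sum := by
    rcases eq_or_ne (cfMatProd l 1 j) 0 with h0 | h0
    · rw [h0, map_zero, absVal_zero]
      positivity
    · rw [absVal_polyEmb h0]
      exact pow_le_pow_right₀ one_le_two (natDegree_cfMatProd_le l 1 j)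
  refine (absVal_sub_le_max _ _).trans (max_le ((hentry 0).trans ?_) ?_)
  · exact le_mul_of_one_le_left (by positivity) hF
  · rw [absVal_mul]
    exact mul_le_mul_of_nonneg_left (hentry 1) (absVal_nonneg F)

end DenomError

section PhiSeries

variable {p : ℕ} [Fact p.Prime] {Φ : LaurentSeries (ZMod p)}

lemma natDegree_phiQuotients (hp : 5 ≤ p) (n : ℕ) : (phiQuotients p n).natDegree = 1 := by
  rw [phiQuotients]
  split_ifs
  · exact natDegree_three_mul_X hp
  · exact natDegree_xDivThree hp

lemma phi_eq (hΦ : HasContFrac Φ (phiQuotients p)) :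
    Φ = polyEmb (3 * X) + (completeQuotient Φ 1)⁻¹ :=
  hΦ.completeQuotient_eq 0

lemma completeQuotient_phi_two (hp : 5 ≤ p) (hΦ : HasContFrac Φ (phiQuotients p)) :
    completeQuotient Φ 2 = Φ := by
  have hperiod : (fun n => phiQuotients p (2 + n)) = phiQuotients p := by
    funext n
    simp [phiQuotients, Nat.even_add]
  exact (hperiod ▸ hΦ.drop 2).unique hΦ fun n => (natDegree_phiQuotients hp n).ge

lemma completeQuotient_phi_one (hp : 5 ≤ p) (hΦ : HasContFrac Φ (phiQuotients p)) :
    completeQuotient Φ 1 = polyEmb (xDivThree p) + Φ⁻¹ := by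
  conv_rhs => rw [← completeQuotient_phi_two hp hΦ]
  exact hΦ.completeQuotient_eq 1

lemma absVal_completeQuotient_phi (hp : 5 ≤ p) (hΦ : HasContFrac Φ (phiQuotients p)) (n : ℕ) :
    absVal (completeQuotient Φ n) = 2 := by
  have hdeg := natDegree_phiQuotients hp n
  rw [(hΦ.drop n).absVal_eq hdeg.ge, add_zero, absVal_polyEmb (ne_zero_of_natDegree_gt hdeg.ge),
    hdeg, pow_one]

lemma absVal_phi (hp : 5 ≤ p) (hΦ : HasContFrac Φ (phiQuotients p)) : absVal Φ = 2 :=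
  absVal_completeQuotient_phi hp hΦ 0

lemma phi_mul_completeQuotient_one (hp : 5 ≤ p) (hΦ : HasContFrac Φ (phiQuotients p)) :
    Φ * completeQuotient Φ 1 = 3 * polyEmb X * completeQuotient Φ 1 + 1 := by
  have h := congrArg (· * completeQuotient Φ 1) (phi_eq hΦ)
  simpa only [add_mul, map_mul, map_ofNat, inv_mul_cancel₀
    (ne_zero_of_two_le_absVal (absVal_completeQuotient_phi hp hΦ 1).ge)] using h

lemma nine_mul_completeQuotient_phi_one (hp : 5 ≤ p) (hΦ : HasContFrac Φ (phiQuotients p)) :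
    9 * completeQuotient Φ 1 = Φ := by
  have hfst := phi_mul_completeQuotient_one hp hΦ
  have hsnd := congrArg (· * Φ) (completeQuotient_phi_one hp hΦ)
  simp only [add_mul, xDivThree, map_mul,
    inv_mul_cancel₀ (ne_zero_of_two_le_absVal (absVal_phi hp hΦ).ge)] at hsnd
  apply mul_left_cancel₀ (polyEmb_ne_zero (X_ne_zero (R := ZMod p)))
  linear_combination 3 * hsnd - 3 * hfst
    + polyEmb X * Φ * polyEmb_C_three_inv_mul_three hp

lemma phi_sq (hp : 5 ≤ p) (hΦ : HasContFrac Φ (phiQuotients p)) :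
    Φ ^ 2 - polyEmb (3 * X) * Φ - 9 = 0 := by
  rw [map_mul, map_ofNat]
  linear_combination 9 * phi_mul_completeQuotient_one hp hΦ
    + (3 * polyEmb X - Φ) * nine_mul_completeQuotient_phi_one hp hΦ

lemma absVal_denomError_phi_append_replicate (hp : 5 ≤ p) (hΦ : HasContFrac Φ (phiQuotients p))
    (l : List (ZMod p)[X]) (n : ℕ) :
    absVal (denomError Φ (l ++ (List.replicate n [xDivThree p, 3 * X]).flatten)) =
      absVal (denomError Φ l) / 4 ^ n := by
  have hΦ2 := absVal_phi hp hΦ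
  have hΨ2 := absVal_completeQuotient_phi hp hΦ 1
  have hpair (l : List (ZMod p)[X]) :
      absVal (denomError Φ (l ++ [xDivThree p, 3 * X])) = absVal (denomError Φ l) / 4 := by
    have hfst := absVal_denomError_concat (3 * X) (ne_zero_of_two_le_absVal hΨ2.ge)
      (l ++ [xDivThree p])
    have hsnd := absVal_denomError_concat (xDivThree p) (ne_zero_of_two_le_absVal hΦ2.ge) l
    rw [← phi_eq hΦ, hΨ2, List.append_assoc] at hfst
    rw [← completeQuotient_phi_one hp hΦ, hΦ2] at hsnd
    rw [← List.singleton_append, hfst, hsnd]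
    ring
  induction n with
  | zero => simp
  | succ n ih =>
    rw [List.replicate_succ', List.flatten_append, List.flatten_singleton, ← List.append_assoc,
      hpair, ih, div_div, pow_succ]

/- With `Ψ` the complete quotient of index `1` and `Φ = 9 Ψ`, one has
`q Φ - (3 X q + 9 q') = (q - Φ q') / Ψ` for the last two denominators `q`, `q'` of `l`. -/
lemma fracNorm_mul_phi_le (hp : 5 ≤ p) (hΦ : HasContFrac Φ (phiQuotients p))
    (l : List (ZMod p)[X]) :
    fracNorm (polyEmb (cfMatProd l 1 0) * Φ) ≤ absVal (denomError Φ l) / 2 := by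
  have hΨ2 := absVal_completeQuotient_phi hp hΦ 1
  have hdiff : polyEmb (cfMatProd l 1 0) * Φ
      - polyEmb (3 * X * cfMatProd l 1 0 + 9 * cfMatProd l 1 1) =
        denomError Φ l / completeQuotient Φ 1 := by
    rw [eq_div_iff (ne_zero_of_two_le_absVal hΨ2.ge), denomError]
    simp only [map_add, map_mul, map_ofNat]
    linear_combination polyEmb (cfMatProd l 1 0) * phi_mul_completeQuotient_one hp hΦ
      - polyEmb (cfMatProd l 1 1) * nine_mul_completeQuotient_phi_one hp hΦ
  rw [← hΨ2, ← absVal_div, ← hdiff]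
  exact fracNorm_le _ _

end PhiSeries

section Littlewood

lemma littlewood_of_forall_exists_le {K : Type*} [Field K] {Θ Φ : LaurentSeries K} {u : ℕ → ℝ}
    (hu : Filter.Tendsto u Filter.atTop (nhds 0))
    (h : ∀ k, ∃ q : K[X], q ≠ 0 ∧
      absVal (polyEmb q) * fracNorm (polyEmb q * Θ) * fracNorm (polyEmb q * Φ) ≤ u k) :
    Littlewood Θ Φ := by
  have hnonneg (q : {q : K[X] // q ≠ 0}) :
      0 ≤ absVal (polyEmb q.1) * fracNorm (polyEmb q.1 * Θ) * fracNorm (polyEmb q.1 * Φ) :=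
    mul_nonneg (mul_nonneg (absVal_nonneg _) (fracNorm_nonneg _)) (fracNorm_nonneg _)
  refine le_antisymm (ge_of_tendsto' hu fun k => ?_) (Real.iInf_nonneg hnonneg)
  obtain ⟨q, hq, hle⟩ := h k
  exact (ciInf_le ⟨0, Set.forall_mem_range.2 hnonneg⟩ ⟨q, hq⟩).trans hle

variable {p : ℕ} [Fact p.Prime] {Θ Φ : LaurentSeries (ZMod p)}

lemma length_thetaPrefix_le (hp : 5 ≤ p) (k : ℕ) :
    (thetaPrefix p k).length ≤ (p ^ k - 1) / 2 := by
  induction k with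
  | zero => simp [thetaPrefix]
  | succ k ih =>
    obtain ⟨m, hm⟩ := ((Fact.out : p.Prime).odd_of_ne_two (by omega)).pow (n := k)
    have hpow : 5 * p ^ k ≤ p ^ (k + 1) := by
      rw [pow_succ']
      gcongr
    rw [thetaPrefix_succ, List.length_append, length_thetaBlock]
    omega

variable (p) in
/-- The beginning `…, X, L_k(3)` of the continued fraction of `Θ`, which ends with a long part of
the reversed continued fraction of `Φ`. -/
noncomputable def littlewoodWord (k : ℕ) : List (ZMod p)[X] :=
  thetaPrefix p k ++ X :: wordLThree p k

lemma thetaPrefix_succ_eq_littlewoodWord (k : ℕ) :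
    thetaPrefix p (k + 1) = littlewoodWord p k ++ (-xDivThree p) :: wordLNegOne p k := by
  rw [thetaPrefix_succ, thetaBlock, littlewoodWord, List.append_assoc, List.cons_append]

lemma one_le_natDegree_of_mem_littlewoodWord (hp : 5 ≤ p) {k : ℕ} {a : (ZMod p)[X]}
    (ha : a ∈ littlewoodWord p k) : 1 ≤ a.natDegree :=
  (natDegree_of_mem_thetaPrefix (k := k + 1) hp
    (thetaPrefix_succ_eq_littlewoodWord (p := p) k ▸ List.mem_append_left _ ha)).ge

lemma littlewoodWord_ne_nil (k : ℕ) : littlewoodWord p k ≠ [] := by simp [littlewoodWord]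

lemma cfMatProd_littlewoodWord_ne_zero (hp : 5 ≤ p) (k : ℕ) :
    cfMatProd (littlewoodWord p k) 1 0 ≠ 0 :=
  ne_zero_of_degree_gt (degree_cfMatProd_lt (littlewoodWord_ne_nil k)
    fun _ => one_le_natDegree_of_mem_littlewoodWord hp)

lemma absVal_mul_fracNorm_theta_le (hp : 5 ≤ p) (hΘ : HasContFrac Θ (thetaQuotients p)) (k : ℕ) :
    absVal (polyEmb (cfMatProd (littlewoodWord p k) 1 0)) *
      fracNorm (polyEmb (cfMatProd (littlewoodWord p k) 1 0) * Θ) ≤ 1 := by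
  have hrest : ∀ a ∈ (-xDivThree p) :: wordLNegOne p k, 1 ≤ a.natDegree := fun a ha =>
    (natDegree_of_mem_thetaPrefix (k := k + 1) hp
      (thetaPrefix_succ_eq_littlewoodWord (p := p) k ▸ List.mem_append_right _ ha)).ge
  have hΘk := eq_cfEval_thetaTail hΘ (k + 1)
  rw [thetaPrefix_succ_eq_littlewoodWord, cfEval_append] at hΘk
  conv_lhs => rw [hΘk]
  exact absVal_mul_fracNorm_cfEval_le_one (littlewoodWord_ne_nil k)
    (fun _ => one_le_natDegree_of_mem_littlewoodWord hp)
    (two_le_absVal_cfEval hrest (absVal_thetaTail hp hΘ (k + 1)).ge)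

lemma absVal_denomError_phi_le (hp : 5 ≤ p) (hΦ : HasContFrac Φ (phiQuotients p))
    {l : List (ZMod p)[X]} (hl : ∀ a ∈ l, a.natDegree = 1) :
    absVal (denomError Φ l) ≤ 2 * 2 ^ l.length := by
  have hsum : (l.map natDegree).sum = l.length := by
    rw [List.sum_eq_card_nsmul _ 1 (by simpa using hl), List.length_map, smul_eq_mul, mul_one]
  have h := absVal_denomError_le (one_le_two.trans (absVal_phi hp hΦ).ge) l
  rwa [absVal_phi hp hΦ, hsum] at h

lemma fracNorm_phi_le (hp : 5 ≤ p) (hΦ : HasContFrac Φ (phiQuotients p)) (k : ℕ) :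
    fracNorm (polyEmb (cfMatProd (littlewoodWord p k) 1 0) * Φ) ≤ 2 / 4 ^ k := by
  have hdeg : ∀ a ∈ thetaPrefix p k ++ [(X : (ZMod p)[X])], a.natDegree = 1 :=
    List.forall_mem_append.2
      ⟨fun _ => natDegree_of_mem_thetaPrefix hp, List.forall_mem_singleton.2 natDegree_X⟩
  have herror := absVal_denomError_phi_le hp hΦ hdeg
  rw [List.length_append, List.length_singleton, pow_succ] at herror
  have hlen : (2 : ℝ) ^ (thetaPrefix p k).length * 4 ^ k ≤ 4 ^ ((p ^ k - 1) / 2) := by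
    have hlower := two_mul_le_length_thetaPrefix p k
    have hupper := length_thetaPrefix_le hp k
    rw [show (4 : ℝ) = 2 ^ 2 by norm_num, ← pow_mul, ← pow_mul, ← pow_add]
    exact pow_le_pow_right₀ one_le_two (by omega)
  refine (fracNorm_mul_phi_le hp hΦ _).trans ?_
  rw [littlewoodWord, List.append_cons, wordLThree, absVal_denomError_phi_append_replicate hp hΦ,
    div_div, div_le_div_iff₀ (by positivity) (by positivity)]
  calc absVal (denomError Φ (thetaPrefix p k ++ [(X : (ZMod p)[X])])) * 4 ^ k
      ≤ 2 * (2 ^ (thetaPrefix p k).length * 2) * 4 ^ k := by gcongr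
    _ ≤ 2 * (4 ^ ((p ^ k - 1) / 2) * 2) := by linarith

theorem littlewood_theta_phi (hp : 5 ≤ p) (hΘ : HasContFrac Θ (thetaQuotients p))
    (hΦ : HasContFrac Φ (phiQuotients p)) : Littlewood Θ Φ := by
  have hlim : Filter.Tendsto (fun k : ℕ => (2 : ℝ) / 4 ^ k) Filter.atTop (nhds 0) :=
    tendsto_const_nhds.div_atTop (tendsto_pow_atTop_atTop_of_one_lt (by norm_num))
  refine littlewood_of_forall_exists_le hlim fun k => ?_
  exact ⟨_, cfMatProd_littlewoodWord_ne_zero hp k,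
    (mul_le_mul (absVal_mul_fracNorm_theta_le hp hΘ k) (fracNorm_phi_le hp hΦ k)
      (fracNorm_nonneg _) zero_le_one).trans_eq (one_mul _)⟩

end Littlewood

section GaussNorm

variable {L : Type*} [Field L] {v : AbsoluteValue L ℝ} {c : ℝ} {P : L[X]}

lemma gaussNorm_pos (hc : 0 < c) (hP : P ≠ 0) : 0 < P.gaussNorm v c :=
  (gaussNorm_nonneg v P hc.le).lt_of_ne'
    ((gaussNorm_eq_zero_iff v P (fun _ => v.eq_zero.mp) hc).not.mpr hP)

/-- The Newton polygon of `P` with respect to `v` is a segment of slope determined by `c`: the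
Gauss norm of `P` is attained at the constant and at the leading coefficient. -/
def IsGaussPure (v : AbsoluteValue L ℝ) (c : ℝ) (P : L[X]) : Prop :=
  v (P.coeff 0) = P.gaussNorm v c ∧ v P.leadingCoeff * c ^ P.natDegree = P.gaussNorm v c

lemma IsGaussPure.of_mul (hv : IsNonarchimedean v) (hc : 0 < c) {A B : L[X]} (hA : A ≠ 0)
    (hB : B ≠ 0) (h : IsGaussPure v c (A * B)) : IsGaussPure v c A ∧ IsGaussPure v c B := by
  obtain ⟨hzero, hlead⟩ := h
  have hApos := gaussNorm_pos (v := v) hc hA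
  have hBpos := gaussNorm_pos (v := v) hc hB
  have coeff_zero_le (Q : L[X]) : v (Q.coeff 0) ≤ Q.gaussNorm v c := by
    simpa using le_gaussNorm v Q hc.le 0
  have lead_le (Q : L[X]) : v Q.leadingCoeff * c ^ Q.natDegree ≤ Q.gaussNorm v c :=
    le_gaussNorm v Q hc.le _
  rw [mul_coeff_zero, map_mul, gaussNorm_mul hv hc] at hzero
  rw [leadingCoeff_mul, natDegree_mul hA hB, map_mul, pow_add, mul_mul_mul_comm,
    gaussNorm_mul hv hc] at hlead
  have hApos₀ : 0 < v (A.coeff 0) :=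
    (v.nonneg _).lt_of_ne' (left_ne_zero_of_mul (hzero ▸ (mul_pos hApos hBpos).ne'))
  have hApos₁ : 0 < v A.leadingCoeff * c ^ A.natDegree :=
    mul_pos (v.pos (leadingCoeff_ne_zero.mpr hA)) (pow_pos hc _)
  obtain ⟨hA₀, hB₀⟩ := (mul_eq_mul_iff_eq_and_eq_of_pos (coeff_zero_le A) (coeff_zero_le B)
    hApos₀ hBpos).mp hzero
  obtain ⟨hA₁, hB₁⟩ := (mul_eq_mul_iff_eq_and_eq_of_pos (lead_le A) (lead_le B)
    hApos₁ hBpos).mp hlead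
  exact ⟨⟨hA₀, hA₁⟩, ⟨hB₀, hB₁⟩⟩

lemma IsGaussPure.pow_natDegree_mem_range (h : IsGaussPure v c P) (hP : P ≠ 0) :
    c ^ P.natDegree ∈ Set.range v := by
  have hlead : v P.leadingCoeff ≠ 0 := v.ne_zero (leadingCoeff_ne_zero.mpr hP)
  refine ⟨P.coeff 0 / P.leadingCoeff, ?_⟩
  rw [map_div₀, h.1, ← h.2, mul_div_cancel_left₀ _ hlead]

/-- The irreducibility criterion of Eisenstein and Dumas. -/
theorem IsGaussPure.irreducible (hv : IsNonarchimedean v) (hc : 0 < c) (h : IsGaussPure v c P)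
    (hdeg : 0 < P.natDegree) (hdvd : ∀ m : ℕ, c ^ m ∈ Set.range v → P.natDegree ∣ m) :
    Irreducible P := by
  have hP : P ≠ 0 := ne_zero_of_natDegree_gt hdeg
  refine ⟨not_isUnit_of_natDegree_pos P hdeg, ?_⟩
  rintro A B rfl
  have hA : A ≠ 0 := left_ne_zero_of_mul hP
  have hB : B ≠ 0 := right_ne_zero_of_mul hP
  have hmul : (A * B).natDegree = A.natDegree + B.natDegree := natDegree_mul hA hB
  have hdvdA := hdvd _ ((h.of_mul hv hc hA hB).1.pow_natDegree_mem_range hA)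
  have isUnit_of_natDegree {Q : L[X]} (hQ : Q ≠ 0) (hQ₀ : Q.natDegree = 0) : IsUnit Q :=
    isUnit_iff_degree_eq_zero.mpr ((degree_eq_iff_natDegree_eq hQ).mpr hQ₀)
  rcases Nat.eq_zero_or_pos A.natDegree with hA₀ | hApos
  · exact Or.inl (isUnit_of_natDegree hA hA₀)
  · have := Nat.le_of_dvd hApos hdvdA
    exact Or.inr (isUnit_of_natDegree hB (by omega))

lemma gaussNorm_X_sub_C_le (hv : IsNonarchimedean v) (hc : 0 ≤ c) (θ : L) :
    (X - C θ).gaussNorm v c ≤ max c (v θ) := by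
  have hadd := isNonarchimedean_gaussNorm v hv hc X (C (-θ))
  rwa [C_neg, ← sub_eq_add_neg, ← C_neg, gaussNorm_C, v.map_neg, ← monomial_one_one_eq_X,
    gaussNorm_monomial, v.map_one, one_mul, pow_one] at hadd

lemma gaussNorm_C_mul_X_sub_C_pow_le (hv : IsNonarchimedean v) (hc : 0 < c) (a θ : L) (n : ℕ) :
    (C a * (X - C θ) ^ n).gaussNorm v c ≤ v a * max c (v θ) ^ n := by
  have habs : IsAbsoluteValue (gaussNorm (R := L) v c) := gaussNorm_isAbsoluteValue hv hc
  rw [gaussNorm_mul hv hc, gaussNorm_C, IsAbsoluteValue.abv_pow (gaussNorm v c)]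
  gcongr
  · exact gaussNorm_nonneg v _ hc.le
  · exact gaussNorm_X_sub_C_le hv hc.le θ

lemma natDegree_C_mul_X_pow_add_add_C {n : ℕ} {a b : L} {E : L[X]} (ha : a ≠ 0)
    (hE : E.natDegree < n) : (C a * X ^ n + E + C b).natDegree = n := by
  rw [natDegree_add_C, natDegree_add_eq_left_of_natDegree_lt] <;> rw [natDegree_C_mul_X_pow n a ha]
  exact hE

lemma isGaussPure_C_mul_X_pow_add_add_C (hv : IsNonarchimedean v) (hc : 0 < c) {n : ℕ} {a b : L}
    {E : L[X]} (hab : v a * c ^ n = v b) (hEdeg : E.natDegree < n)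
    (hE : E.gaussNorm v c < v b) : IsGaussPure v c (C a * X ^ n + E + C b) := by
  set P := C a * X ^ n + E + C b with hP
  have hn : n ≠ 0 := (Nat.zero_le _).trans_lt hEdeg |>.ne'
  have ha : a ≠ 0 := by
    rintro rfl
    rw [map_zero, zero_mul] at hab
    exact (gaussNorm_nonneg v E hc.le).not_gt (hab ▸ hE)
  have hdeg : P.natDegree = n := natDegree_C_mul_X_pow_add_add_C ha hEdeg
  have hlead : P.leadingCoeff = a := by
    rw [leadingCoeff, hdeg, hP, coeff_add, coeff_add, coeff_C_mul_X_pow, if_pos rfl,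
      coeff_eq_zero_of_natDegree_lt hEdeg, coeff_C_of_ne_zero hn, add_zero, add_zero]
  have hE₀ : v (E.coeff 0) < v b :=
    (by simpa using le_gaussNorm v E hc.le 0 : v (E.coeff 0) ≤ _).trans_lt hE
  have hzero : v (P.coeff 0) = v b := by
    rw [hP, coeff_add, coeff_add, coeff_C_mul_X_pow, if_neg hn.symm, coeff_C_zero, zero_add]
    exact hv.add_eq_right_of_lt hE₀
  have hnorm : P.gaussNorm v c = v b := by
    refine le_antisymm ?_ ?_
    · have hadd := isNonarchimedean_gaussNorm v hv hc.le
      refine (hadd _ _).trans (max_le ((hadd _ _).trans (max_le ?_ hE.le)) ?_)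
      · rw [C_mul_X_pow_eq_monomial, gaussNorm_monomial, hab]
      · rw [gaussNorm_C]
    · simpa [hzero] using le_gaussNorm v P hc.le 0
  exact ⟨hzero.trans hnorm.symm, by rw [hlead, hdeg, hab, hnorm]⟩

end GaussNorm

section MinimalDegree

lemma natDegree_minpoly_eq_of_map_eq {k L : Type*} [Field k] [Field L] [Algebra k L] {θ : L}
    (hθ : θ ∉ (algebraMap k L).range) {M : k[X]} {Q : L[X]} (hQ : Irreducible Q)
    (hM : M.map (algebraMap k L) = (X - C θ) * Q) : (minpoly k θ).natDegree = M.natDegree := by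
  have hroot : aeval θ M = 0 := by
    rw [aeval_def, ← eval_map, hM, eval_mul, eval_sub, eval_X, eval_C, sub_self, zero_mul]
  obtain ⟨N, rfl⟩ := minpoly.dvd k θ hroot
  obtain ⟨μ, hμ⟩ : X - C θ ∣ (minpoly k θ).map (algebraMap k L) := by
    rw [dvd_iff_isRoot, IsRoot, eval_map, ← aeval_def, minpoly.aeval]
  have hμN : Q = μ * N.map (algebraMap k L) := by
    apply mul_left_cancel₀ (X_sub_C_ne_zero θ)
    rw [← hM, Polynomial.map_mul, hμ, mul_assoc]
  have hN : N ≠ 0 := by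
    rintro rfl
    exact hQ.ne_zero (by simp [hμN])
  rcases hQ.isUnit_or_isUnit hμN with hunit | hunit
  · have hdeg : (minpoly k θ).degree = 1 := by
      rw [← degree_map (minpoly k θ) (algebraMap k L), hμ, degree_mul, degree_X_sub_C,
        degree_eq_zero_of_isUnit hunit, add_zero]
    exact absurd (minpoly.mem_range_of_degree_eq_one k θ hdeg) hθ
  · have hmin : minpoly k θ ≠ 0 := by
      rintro h
      rw [h, zero_mul, Polynomial.map_zero] at hM
      exact mul_ne_zero (X_sub_C_ne_zero θ) hQ.ne_zero hM.symm
    have hNdeg : N.natDegree = 0 := by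
      rw [← natDegree_map (algebraMap k L), natDegree_eq_zero_of_isUnit hunit]
    rw [natDegree_mul hmin hN, hNdeg, add_zero]

theorem natDegree_le_of_eval₂_eq_zero {R L : Type*} [CommRing R] [IsDomain R] [Field L]
    {f : R →+* L} (hf : Function.Injective f) {θ : L}
    (hθ : ∀ q r : R, f q * θ = f r → q = 0) {M : R[X]} {Q : L[X]} (hQ : Irreducible Q)
    (hM : M.map f = (X - C θ) * Q) {P : R[X]} (hP : P ≠ 0) (hPθ : P.eval₂ f θ = 0) :
    M.natDegree ≤ P.natDegree := by
  let k := FractionRing R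
  let _ : Algebra k L := (IsFractionRing.lift hf).toAlgebra
  have halg (x : R) : algebraMap k L (algebraMap R k x) = f x := IsFractionRing.lift_algebraMap hf x
  have hcomp : (algebraMap k L).comp (algebraMap R k) = f := RingHom.ext halg
  have hinj : Function.Injective (algebraMap R k) := IsFractionRing.injective R k
  have hθk : θ ∉ (algebraMap k L).range := by
    rintro ⟨x, rfl⟩
    obtain ⟨r, q, hq, rfl⟩ := IsFractionRing.div_surjective (A := R) x
    have hq₀ : q ≠ 0 := nonZeroDivisors.ne_zero hq
    refine hq₀ (hθ q r ?_)
    rw [map_div₀, halg, halg, mul_div_cancel₀ _ ((map_ne_zero_iff f hf).mpr hq₀)]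
  rw [← natDegree_map_eq_of_injective hinj M, ← natDegree_map_eq_of_injective hinj P,
    ← natDegree_minpoly_eq_of_map_eq hθk hQ (by rw [map_map, hcomp, hM])]
  refine natDegree_le_of_dvd (minpoly.dvd k θ ?_) ((Polynomial.map_ne_zero_iff hinj).mpr hP)
  rw [aeval_def, eval₂_map, hcomp, hPθ]

end MinimalDegree

section ThetaDegree

variable {p : ℕ} [Fact p.Prime] {Θ : LaurentSeries (ZMod p)}

lemma natDegree_mrPoly (hp : 5 ≤ p) : (mrPoly p).natDegree = p + 1 := by
  have hp₁ : p ≠ 0 := by omega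
  rw [mrPoly, natDegree_add_C]
  compute_degree <;> simp [hp₁]

/-- The quotient of `mrPoly p` by its linear factor `Z - Θ`, in the form that shows its Newton
polygon: the middle summand is a small perturbation. -/
noncomputable def thetaCofactor (Θ : LaurentSeries (ZMod p)) : (LaurentSeries (ZMod p))[X] :=
  C (polyEmb X) * X ^ p
    + C (polyEmb X * Θ - (polyEmb X ^ 2 - 3)) * (X - C Θ) ^ (p - 1)
    + C (polyEmb (X * mrF p (p - 2) - 3 * mrF p (p - 1)))

lemma map_mrPoly_eq_mul_thetaCofactor (hp : 5 ≤ p) (hΘ : HasContFrac Θ (thetaQuotients p)) :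
    (mrPoly p).map polyEmb = (X - C Θ) * thetaCofactor Θ := by
  have hfrob : (X - C Θ) * (X - C Θ) ^ (p - 1) = X ^ p - C Θ ^ p := by
    rw [mul_pow_sub_one (Fact.out : p.Prime).ne_zero, sub_pow_char]
  have hroot := congrArg C (mrPoly_eval hp hΘ)
  simp only [mrPoly, eval₂_add, eval₂_sub, eval₂_mul, eval₂_C, eval₂_pow, eval₂_X] at hroot
  simp only [mrPoly, thetaCofactor, Polynomial.map_add, Polynomial.map_sub, Polynomial.map_mul,
    Polynomial.map_pow, map_C, map_X]
  simp only [map_add, map_sub, map_mul, map_neg, map_pow, map_ofNat, map_zero] at hroot ⊢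
  linear_combination hroot - (C (polyEmb X) * C Θ - (C (polyEmb X) ^ 2 - 3)) * hfrob

lemma absVal_theta_sub_X_lt_one (hΘ : HasContFrac Θ (thetaQuotients p)) :
    absVal (Θ - polyEmb X) < 1 := by
  have hquot : thetaQuotients p 0 = X := by simp [thetaQuotients, thetaBlock]
  have hfrac := absVal_fracPart_lt_one Θ
  have hpart : polyPart Θ = thetaQuotients p 0 := (hΘ 0).2
  rwa [fracPart, hpart, hquot] at hfrac

lemma absVal_X_mul_theta_sub_lt_one (hp : 5 ≤ p) (hΘ : HasContFrac Θ (thetaQuotients p)) :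
    absVal (polyEmb X * Θ - (polyEmb X ^ 2 - 3)) < 1 := by
  have hthree : absVal (3 : LaurentSeries (ZMod p)) = 1 := by
    have hne : (3 : (ZMod p)[X]) ≠ 0 := by
      rw [← map_ofNat C 3]
      exact C_ne_zero.mpr (three_ne_zero_zmod hp)
    rw [← map_ofNat polyEmb 3, absVal_polyEmb hne, natDegree_ofNat, pow_zero]
  have h := congrArg absVal (sub_mul_thetaTail_one hp hΘ)
  rw [absVal_mul, absVal_mul, absVal_thetaTail hp hΘ, hthree, one_mul] at h
  linarith [absVal_theta_sub_X_lt_one hΘ, absVal_nonneg (polyEmb X * Θ - (polyEmb X ^ 2 - 3))]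

lemma absVal_X_mul_mrF_sub (hp : 5 ≤ p) :
    absVal (polyEmb (X * mrF p (p - 2) - 3 * mrF p (p - 1))) = 2 ^ (p - 1) := by
  have hXh : IsMonicOfDegree (X * mrF p (p - 2)) (p - 1) := by
    rw [show p - 1 = 1 + (p - 2) by omega]
    exact (isMonicOfDegree_X _).mul (isMonicOfDegree_mrF p (p - 2))
  obtain ⟨hXh_deg, hXh_coeff⟩ := (isMonicOfDegree_iff _ _).mp hXh
  obtain ⟨hg_deg, hg_coeff⟩ := (isMonicOfDegree_iff _ _).mp (isMonicOfDegree_mrF p (p - 1))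
  have hne : (X * mrF p (p - 2) - 3 * mrF p (p - 1)).coeff (p - 1) ≠ 0 := by
    rw [coeff_sub, coeff_ofNat_mul, hXh_coeff, hg_coeff, show (1 - 3 * 1 : ZMod p) = -2 by norm_num]
    exact neg_ne_zero.mpr (Ring.two_ne_zero (by rw [ZMod.ringChar_zmod_n]; omega))
  have hdeg : (X * mrF p (p - 2) - 3 * mrF p (p - 1)).natDegree = p - 1 := by
    refine natDegree_eq_of_le_of_coeff_ne_zero ?_ hne
    refine (natDegree_sub_le_of_le hXh_deg ?_).trans_eq (max_self _)
    exact (natDegree_mul_le_of_le (natDegree_ofNat 3).le hg_deg).trans_eq (zero_add _)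
  rw [absVal_polyEmb (by rintro h; simp [h] at hne), hdeg]

/-- The slope `2 ^ ((p - 2) / p)` of the Newton polygon of `thetaCofactor Θ`: the absolute value of
each of its roots. -/
noncomputable def thetaSlope (p : ℕ) : ℝ := 2 ^ (((p - 2 : ℕ) : ℝ) / p)

lemma thetaSlope_pos (p : ℕ) : 0 < thetaSlope p := Real.rpow_pos_of_pos two_pos _

omit [Fact p.Prime] in
lemma thetaSlope_pow (hp : p ≠ 0) : thetaSlope p ^ p = 2 ^ (p - 2) := by
  rw [thetaSlope, ← Real.rpow_mul_natCast zero_le_two, div_mul_cancel₀ _ (Nat.cast_ne_zero.mpr hp),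
    Real.rpow_natCast]

lemma thetaSlope_le_two (p : ℕ) : thetaSlope p ≤ 2 := by
  rw [thetaSlope]
  refine (Real.rpow_le_rpow_of_exponent_le one_le_two ?_).trans (Real.rpow_one 2).le
  exact div_le_one_of_le₀ (Nat.cast_le.mpr (Nat.sub_le p 2)) p.cast_nonneg

lemma dvd_of_thetaSlope_pow_mem_range (hp : 5 ≤ p) {m : ℕ}
    (h : thetaSlope p ^ m ∈ Set.range (laurentAbs (ZMod p))) : p ∣ m := by
  obtain ⟨F, hF : absVal F = thetaSlope p ^ m⟩ := h
  have hF₀ : F ≠ 0 := by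
    rintro rfl
    exact (pow_pos (thetaSlope_pos p) m).ne (absVal_zero.symm.trans hF)
  have hpow : (2 : ℝ) ^ (-F.order * p) = 2 ^ (((p - 2) * m : ℕ) : ℤ) := by
    rw [zpow_mul, ← absVal_of_ne_zero hF₀, hF, zpow_natCast, zpow_natCast, pow_right_comm,
      thetaSlope_pow (by omega), pow_mul]
  have hexp : -F.order * p = ((p - 2) * m : ℕ) := zpow_right_injective₀ two_pos (by norm_num) hpow
  have hdvd : p ∣ (p - 2) * m := Int.natCast_dvd_natCast.mp (Dvd.intro_left _ hexp)
  refine ((Fact.out : p.Prime).dvd_mul.mp hdvd).resolve_left fun hdiv => ?_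
  exact absurd (Nat.le_of_dvd (by omega) hdiv) (by omega)

lemma natDegree_thetaCofactor_middle_lt (hp : 5 ≤ p) (F Θ : LaurentSeries (ZMod p)) :
    (C F * (X - C Θ) ^ (p - 1)).natDegree < p := by
  refine (natDegree_C_mul_le _ _).trans_lt ?_
  rw [natDegree_pow, natDegree_X_sub_C]
  omega

lemma natDegree_thetaCofactor (hp : 5 ≤ p) : (thetaCofactor Θ).natDegree = p :=
  natDegree_C_mul_X_pow_add_add_C (polyEmb_ne_zero X_ne_zero)
    (natDegree_thetaCofactor_middle_lt hp _ Θ)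

lemma isGaussPure_thetaCofactor (hp : 5 ≤ p) (hΘ : HasContFrac Θ (thetaQuotients p)) :
    IsGaussPure (laurentAbs (ZMod p)) (thetaSlope p) (thetaCofactor Θ) := by
  have hna := laurentAbs_isNonarchimedean (K := ZMod p)
  have hpos := thetaSlope_pos p
  have hconst := absVal_X_mul_mrF_sub hp
  refine isGaussPure_C_mul_X_pow_add_add_C hna hpos ?_ (natDegree_thetaCofactor_middle_lt hp _ Θ) ?_
  · change absVal _ * _ = absVal _
    rw [hconst, absVal_polyEmb X_ne_zero, natDegree_X, thetaSlope_pow (by omega), ← pow_add]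
    congr 1
    omega
  · refine (gaussNorm_C_mul_X_sub_C_pow_le hna hpos _ Θ (p - 1)).trans_lt ?_
    change absVal _ * max _ (absVal Θ) ^ _ < absVal _
    rw [hconst, ← thetaTail_zero (Θ := Θ), absVal_thetaTail hp hΘ, thetaTail_zero,
      max_eq_right (thetaSlope_le_two p)]
    exact mul_lt_of_lt_one_left (by positivity) (absVal_X_mul_theta_sub_lt_one hp hΘ)

lemma irreducible_thetaCofactor (hp : 5 ≤ p) (hΘ : HasContFrac Θ (thetaQuotients p)) :
    Irreducible (thetaCofactor Θ) := by
  have hdeg := natDegree_thetaCofactor (Θ := Θ) hp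
  refine (isGaussPure_thetaCofactor hp hΘ).irreducible laurentAbs_isNonarchimedean
    (thetaSlope_pos p) (by omega) fun m hm => ?_
  rw [hdeg]
  exact dvd_of_thetaSlope_pow_mem_range hp hm

theorem hasAlgDegree_theta (hp : 5 ≤ p) (hΘ : HasContFrac Θ (thetaQuotients p)) :
    HasAlgDegree Θ (p + 1) := by
  have hdeg := natDegree_mrPoly hp
  have hirr := irreducible_thetaCofactor hp hΘ
  refine ⟨⟨mrPoly p, ne_zero_of_natDegree_gt (n := 0) (by omega), mrPoly_eval hp hΘ, hdeg⟩, ?_⟩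
  rintro _ ⟨P, hP, hPΘ, rfl⟩
  rw [← hdeg]
  exact natDegree_le_of_eval₂_eq_zero polyEmb_injective
    (fun _ _ => hΘ.eq_zero_of_mul_eq fun n => (natDegree_thetaQuotients hp n).ge) hirr
    (map_mrPoly_eq_mul_thetaCofactor hp hΘ) hP hPΘ

end ThetaDegree

lemma eq_zero_of_natDegree_le_one {K : Type*} [Field K] {F : LaurentSeries K} {a : ℕ → K[X]}
    (hF : HasContFrac F a) (ha : ∀ n, 1 ≤ (a n).natDegree) {A : K[X][X]}
    (hA : A.natDegree ≤ 1) (h : A.eval₂ polyEmb F = 0) : A = 0 := by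
  rw [eq_X_add_C_of_natDegree_le_one hA] at h ⊢
  simp only [eval₂_add, eval₂_mul, eval₂_C, eval₂_X] at h
  have hlin : A.coeff 1 = 0 :=
    hF.eq_zero_of_mul_eq ha (r := -A.coeff 0) (by rw [map_neg]; exact eq_neg_of_add_eq_zero_left h)
  rw [hlin, map_zero, zero_mul, zero_add, polyEmb_eq_zero] at h
  rw [hlin, h, C_0, zero_mul, add_zero]

section Main

variable {p : ℕ} [Fact p.Prime] {Θ Φ : LaurentSeries (ZMod p)}

theorem hasAlgDegree_phi (hp : 5 ≤ p) (hΦ : HasContFrac Φ (phiQuotients p)) :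
    HasAlgDegree Φ 2 := by
  have hquot (n : ℕ) : 1 ≤ (phiQuotients p n).natDegree := (natDegree_phiQuotients hp n).ge
  constructor
  · have hdeg : (X ^ 2 - C (3 * X) * X - C 9 : (ZMod p)[X][X]).natDegree = 2 := by
      compute_degree!
    refine ⟨X ^ 2 - C (3 * X) * X - C 9, ne_zero_of_natDegree_gt (n := 1) (by omega), ?_, hdeg⟩
    simp only [eval₂_sub, eval₂_mul, eval₂_pow, eval₂_X, eval₂_C, map_ofNat polyEmb]
    exact phi_sq hp hΦ
  · rintro _ ⟨A, hA, hAΦ, rfl⟩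
    by_contra! hlt
    exact hA (eq_zero_of_natDegree_le_one hΦ hquot (Nat.le_of_lt_succ hlt) hAΦ)

/-- A linear relation between `1`, `Θ`, `Φ` involving `Θ` would make `Θ` quadratic, like `Φ`. -/
theorem oneLinIndep_theta_phi (hp : 5 ≤ p) (hΘ : HasContFrac Θ (thetaQuotients p))
    (hΦ : HasContFrac Φ (phiQuotients p)) : OneLinIndep Θ Φ := by
  intro a b c h
  have hb : b = 0 := by
    by_contra hb
    set A : (ZMod p)[X][X] := C (b ^ 2) * X ^ 2 + C (2 * a * b + 3 * X * c * b) * X +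
      C (a ^ 2 + 3 * X * c * a - 9 * c ^ 2) with hA
    have hdeg : A.natDegree = 2 := natDegree_quadratic (pow_ne_zero 2 hb)
    have hA₀ : A ≠ 0 := ne_zero_of_natDegree_gt (n := 1) (by omega)
    have hAΘ : A.eval₂ polyEmb Θ = 0 := by
      have hsq := phi_sq hp hΦ
      simp only [hA, eval₂_add, eval₂_mul, eval₂_pow, eval₂_X, eval₂_C]
      simp only [map_add, map_sub, map_mul, map_pow, map_ofNat] at hsq ⊢
      linear_combination (polyEmb a + polyEmb b * Θ - polyEmb c * Φ +
        3 * polyEmb X * polyEmb c) * h + polyEmb c ^ 2 * hsq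
    have hle : p + 1 ≤ A.natDegree := (hasAlgDegree_theta hp hΘ).2 ⟨A, hA₀, hAΘ, rfl⟩
    omega
  rw [hb, map_zero, zero_mul, add_zero] at h
  have hc : c = 0 := hΦ.eq_zero_of_mul_eq (fun n => (natDegree_phiQuotients hp n).ge) (r := -a)
    (by rw [map_neg]; exact eq_neg_of_add_eq_zero_right h)
  rw [hc, map_zero, zero_mul, add_zero, polyEmb_eq_zero] at h
  exact ⟨h, hb, hc⟩

end Main

theorem theorem8 (p : ℕ) [Fact p.Prime] (hp : 5 ≤ p) :
    ∃ Θ Φ : LaurentSeries (ZMod p),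
      (∀ F : LaurentSeries (ZMod p), HasContFrac F (thetaQuotients p) ↔ F = Θ) ∧
      (∀ F : LaurentSeries (ZMod p), HasContFrac F (phiQuotients p) ↔ F = Φ) ∧
      (mrPoly p).eval₂ polyEmb Θ = 0 ∧
      HasAlgDegree Θ (p + 1) ∧
      HasAlgDegree Φ 2 ∧
      LittlewoodNontrivially Θ Φ := by
  have hdegΘ := natDegree_thetaQuotients hp
  have hdegΦ := natDegree_phiQuotients hp
  obtain ⟨Θ, hΘ⟩ := exists_hasContFrac fun n => (hdegΘ n).ge
  obtain ⟨Φ, hΦ⟩ := exists_hasContFrac fun n => (hdegΦ n).ge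
  refine ⟨Θ, Φ, fun F => ⟨fun hF => hF.unique hΘ fun n => (hdegΘ n).ge, fun hF => hF ▸ hΘ⟩,
    fun F => ⟨fun hF => hF.unique hΦ fun n => (hdegΦ n).ge, fun hF => hF ▸ hΦ⟩,
    mrPoly_eval hp hΘ, hasAlgDegree_theta hp hΘ, hasAlgDegree_phi hp hΦ,
    littlewood_theta_phi hp hΘ hΦ, ?_, ?_, oneLinIndep_theta_phi hp hΘ hΦ⟩
  · exact hΘ.badlyApproximable (fun n => (hdegΘ n).ge) fun n => (hdegΘ n).le
  · exact hΦ.badlyApproximable (fun n => (hdegΦ n).ge) fun n => (hdegΦ n).le
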